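/- Let $n,m,p\in\mathbb N$ and consider the plant $\dot x = Ax+Bu+w$, $y=Cx+v$ with $A\in\mathbb R^{n\times n}$, $B\in\mathbb R^{n\times m}$, $C\in\mathbb R^{p\times n}$, where $w$ and $v$ are independent white Gaussian noises with intensities $W\succeq 0$ and $V\succ 0$ (i.e. their time integrals are independent Wiener processes with these intensities). Let $Q\succeq 0$, $R\succ 0$, and assume that $(A,B)$ and $(A,W^{1/2})$ are controllable and that $(C,A)$ and $(Q^{1/2},A)$ are observable. A full-order dynamical controller is a matrix $\mathsf K=\begin{bmatrix}0&C_{\mathsf K}\\B_{\mathsf K}&A_{\mathsf K}\end{bmatrix}$ with $A_{\mathsf K}\in\mathbb R^{n\times n}$, $B_{\mathsf K}\in\mathbb R^{n\times p}$, $C_{\mathsf K}\in\mathbb R^{m\times n}$; it stands for $\dot\xi=A_{\mathsf K}\xi+B_{\mathsf K}y$, $u=C_{\mathsf K}\xi$. Let $\mathcal C_n$ be the set of those $\mathsf K$ for which all eigenvalues of $\begin{bmatrix}A&BC_{\mathsf K}\\B_{\mathsf K}C&A_{\mathsf K}\end{bmatrix}$ have negative real part. For $\mathsf K\in\mathcal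 C_n$ let $$J_n(\mathsf K)=\lim_{T\to\infty}\frac1T\,\mathbb E\int_0^T\left(x^{\mathsf T}Qx+u^{\mathsf T}Ru\right)dt$$ along the closed-loop state processes $(x,\xi)$, started from any square-integrable initial state. Let $\nabla J_n$ be the gradient with respect to $(A_{\mathsf K},B_{\mathsf K},C_{\mathsf K})$ for the Frobenius inner product. Let $\alpha_t\ge 0$ be step sizes with $\sum_{t\ge0}\alpha_t=\infty$ (for instance step sizes bounded below by a positive constant), and let $\mathsf K_t\in\mathcal C_n$, $t=0,1,2,\dots$, satisfy $\mathsf K_{t+1}=\mathsf K_t-\alpha_t\nabla J_n(\mathsf K_t)$. Suppose that $\mathsf K_t\to\mathsf K^*$ with $\mathsf K^*\in\mathcal C_n$, and that $\mathsf K^*$ is controllable and observable, i.e. $(A_{\mathsf K^*},B_{\mathsf K^*})$ is controllable and $(C_{\mathsf K^*},A_{\mathsf K^*})$ is observable. Then $\nabla J_n(\mathsf K^*)=0$ and $\mathsf K^*$ is globally optimal: $J_n(\mathsf K^*)\le J_n(\mathsf K)$ for all $\mathsf K\in\mathcal C_n$. (In particular, the expectations and the limit defining $J_n$ exist and are finite,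 and $J_n$ is differentiable, at every point of $\mathcal C_n$.) -/

import Mathlib

open MeasureTheory ProbabilityTheory Filter Topology
open scoped NNReal Matrix MatrixOrder

noncomputable section

/-! ### Controllability, observability, stability -/

/-- The controllability matrix `[B  AB  …  A^{d-1}B]`; its columns are indexed by pairs
(exponent, column of `B`). -/
def controllabilityMatrix {d k : ℕ} (A : Matrix (Fin d) (Fin d) ℝ) (B : Matrix (Fin d) (Fin k) ℝ) :
    Matrix (Fin d) (Fin d × Fin k) ℝ :=
  Matrix.of fun i rj => (A ^ (rj.1 : ℕ) * B) i rj.2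

/-- The observability matrix `[C; CA; …; CA^{d-1}]`; its rows are indexed by pairs
(exponent, row of `C`). -/
def observabilityMatrix {d k : ℕ} (C : Matrix (Fin k) (Fin d) ℝ) (A : Matrix (Fin d) (Fin d) ℝ) :
    Matrix (Fin d × Fin k) (Fin d) ℝ :=
  Matrix.of fun ri j => (C * A ^ (ri.1 : ℕ)) ri.2 j

/-- `(A, B)` is controllable: the controllability matrix has full row rank. -/
def IsControllable {d k : ℕ} (A : Matrix (Fin d) (Fin d) ℝ) (B : Matrix (Fin d) (Fin k) ℝ) : Prop :=
  (controllabilityMatrix A B).rank = d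

/-- `(C, A)` is observable: the observability matrix has full column rank. -/
def IsObservable {d k : ℕ} (C : Matrix (Fin k) (Fin d) ℝ) (A : Matrix (Fin d) (Fin d) ℝ) : Prop :=
  (observabilityMatrix C A).rank = d

/-- A real square matrix is stable if all its (complex) eigenvalues have negative real part. -/
def IsStableMatrix {ι : Type*} [Fintype ι] [DecidableEq ι] (M : Matrix ι ι ℝ) : Prop :=
  ∀ μ ∈ spectrum ℂ (M.map (fun r : ℝ => (r : ℂ))), μ.re < 0

/-! ### The LQG problem data -/

/-- The data of an LQG problem with state dimension `n`, input dimension `m` and output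
dimension `p`: plant `dx = (Ax + Bu) dt + dw`, `y = Cx + v`, cost weights `Q`, `R` and noise
intensities `W`, `V`. -/
structure LQGProblem (n m p : ℕ) where
  A : Matrix (Fin n) (Fin n) ℝ
  B : Matrix (Fin n) (Fin m) ℝ
  C : Matrix (Fin p) (Fin n) ℝ
  Q : Matrix (Fin n) (Fin n) ℝ
  R : Matrix (Fin m) (Fin m) ℝ
  W : Matrix (Fin n) (Fin n) ℝ
  V : Matrix (Fin p) (Fin p) ℝ

/-- The standing assumptions: `Q, W ⪰ 0`, `R, V ≻ 0`, `(A, B)` and `(A, W^{1/2})` are controllable,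
`(C, A)` and `(Q^{1/2}, A)` are observable. `CFC.sqrt` is the positive semidefinite square root. -/
structure LQGProblem.Admissible {n m p : ℕ} (S : LQGProblem n m p) : Prop where
  posSemidef_Q : S.Q.PosSemidef
  posDef_R : S.R.PosDef
  posSemidef_W : S.W.PosSemidef
  posDef_V : S.V.PosDef
  controllable_AB : IsControllable S.A S.B
  controllable_AW : IsControllable S.A (CFC.sqrt S.W)
  observable_CA : IsObservable S.C S.A
  observable_QA : IsObservable (CFC.sqrt S.Q) S.A

/-! ### Full-order dynamical controllers -/

/-- The space of full-order strictly proper controllers `(A_K, B_K, C_K)`, i.e. of the matrices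
`[0 C_K; B_K A_K]`, listed by their entries. Its Euclidean inner product is the
Frobenius (trace) inner product of these matrices. -/
abbrev Controller (n m p : ℕ) : Type :=
  EuclideanSpace ℝ ((Fin n × Fin n) ⊕ (Fin n × Fin p) ⊕ (Fin m × Fin n))

def Controller.AK {n m p : ℕ} (K : Controller n m p) : Matrix (Fin n) (Fin n) ℝ :=
  Matrix.of fun i j => K (Sum.inl (i, j))

def Controller.BK {n m p : ℕ} (K : Controller n m p) : Matrix (Fin n) (Fin p) ℝ :=
  Matrix.of fun i j => K (Sum.inr (Sum.inl (i, j)))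

def Controller.CK {n m p : ℕ} (K : Controller n m p) : Matrix (Fin m) (Fin n) ℝ :=
  Matrix.of fun i j => K (Sum.inr (Sum.inr (i, j)))

/-- The set `𝒞_n` of full-order controllers that internally stabilize the plant. -/
def LQGProblem.stabilizing {n m p : ℕ} (S : LQGProblem n m p) : Set (Controller n m p) :=
  {K | IsStableMatrix (Matrix.fromBlocks S.A (S.B * K.CK) (K.BK * S.C) K.AK)}

/-! ### Noise, closed-loop trajectories and the LQG cost -/

/-- `X` is a Wiener process with intensity matrix `Σ`, that is, the time integral of white Gaussian
noise with intensity `Σ`: it starts at `0`, has continuous paths and independent increments, and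
`X t - X s` is Gaussian with mean `0` and covariance `(t - s) Σ`. -/
structure IsWienerProcess {Ω : Type*} [MeasurableSpace Ω] {d : ℕ} (Sig : Matrix (Fin d) (Fin d) ℝ)
    (X : ℝ≥0 → Ω → EuclideanSpace ℝ (Fin d)) (P : Measure Ω) : Prop where
  start_zero : ∀ᵐ ω ∂P, X 0 ω = 0
  continuous_paths : ∀ᵐ ω ∂P, Continuous fun t => X t ω
  indep_increments : HasIndepIncrements X P
  law_increments : ∀ s t : ℝ≥0, s ≤ t →
    HasLaw (fun ω => X t ω - X s ω) (multivariateGaussian 0 (((t : ℝ) - (s : ℝ)) • Sig)) P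

/-- `(x, ξ)` is a path (on `[0, ∞)`) of the plant state and controller state of the closed loop
`dx = (A x + B u) dt + dw`, `dξ = A_K ξ dt + B_K y dt`, `y dt = C x dt + dv`, `u = C_K ξ`,
in integrated form, for given paths `w`, `v` of the integrated noises. -/
structure LQGProblem.IsClosedLoopPath {n m p : ℕ} (S : LQGProblem n m p) (K : Controller n m p)
    (w : ℝ≥0 → EuclideanSpace ℝ (Fin n)) (v : ℝ≥0 → EuclideanSpace ℝ (Fin p))
    (x ξ : ℝ → Fin n → ℝ) : Prop where
  continuousOn_x : ContinuousOn x (Set.Ici 0)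
  continuousOn_xi : ContinuousOn ξ (Set.Ici 0)
  plant : ∀ t : ℝ≥0, x t =
    x 0 + (∫ s in (0 : ℝ)..t, (S.A *ᵥ x s + S.B *ᵥ (K.CK *ᵥ ξ s))) + (w t).ofLp
  controller : ∀ t : ℝ≥0, ξ t =
    ξ 0 + (∫ s in (0 : ℝ)..t, K.AK *ᵥ ξ s)
      + K.BK *ᵥ ((∫ s in (0 : ℝ)..t, S.C *ᵥ x s) + (v t).ofLp)

/-- The cost `∫₀ᵀ (xᵀ Q x + uᵀ R u) dt`, with `u = C_K ξ`, along a path. -/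
def LQGProblem.runningCost {n m p : ℕ} (S : LQGProblem n m p) (K : Controller n m p)
    (x ξ : ℝ → Fin n → ℝ) (T : ℝ) : ℝ :=
  ∫ t in (0 : ℝ)..T,
    (x t ⬝ᵥ (S.Q *ᵥ x t) + (K.CK *ᵥ ξ t) ⬝ᵥ (S.R *ᵥ (K.CK *ᵥ ξ t)))

/-- `(1/T) 𝔼 ∫₀ᵀ (xᵀ Q x + uᵀ R u) dt`. -/
def LQGProblem.averageCost {n m p : ℕ} (S : LQGProblem n m p) (K : Controller n m p)
    {Ω : Type*} [MeasurableSpace Ω] (P : Measure Ω) (x ξ : ℝ → Ω → Fin n → ℝ) (T : ℝ) : ℝ :=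
  T⁻¹ * ∫ ω, S.runningCost K (fun t => x t ω) (fun t => ξ t ω) T ∂P

/-- The LQG cost `J_n(K) = lim_{T → ∞} (1/T) 𝔼 ∫₀ᵀ (xᵀ Q x + uᵀ R u) dt`, where `x K` and `ξ K` are
the plant and controller state processes of the closed loop with the controller `K`. -/
def LQGProblem.cost {n m p : ℕ} (S : LQGProblem n m p)
    {Ω : Type*} [MeasurableSpace Ω] (P : Measure Ω)
    (x ξ : Controller n m p → ℝ → Ω → Fin n → ℝ) (K : Controller n m p) : ℝ :=
  limUnder atTop (S.averageCost K P (x K) (ξ K))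

/-- The processes `x K`, `ξ K` are, for every stabilizing `K`, state processes of the closed loop
driven by the integrated noises `w`, `v`, from some square-integrable initial state. -/
structure LQGProblem.IsClosedLoopFamily {n m p : ℕ} (S : LQGProblem n m p)
    {Ω : Type*} [MeasurableSpace Ω] (P : Measure Ω)
    (w : ℝ≥0 → Ω → EuclideanSpace ℝ (Fin n)) (v : ℝ≥0 → Ω → EuclideanSpace ℝ (Fin p))
    (x ξ : Controller n m p → ℝ → Ω → Fin n → ℝ) : Prop where
  initial_x : ∀ K ∈ S.stabilizing, MemLp (x K 0) 2 P
  initial_xi : ∀ K ∈ S.stabilizing, MemLp (ξ K 0) 2 P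
  path : ∀ K ∈ S.stabilizing, ∀ᵐ ω ∂P,
    S.IsClosedLoopPath K (fun t => w t ω) (fun t => v t ω)
      (fun t => x K t ω) (fun t => ξ K t ω)

end

/-! ### Matrix exponentials of stable matrices and Lyapunov equations. -/

section Stability

/-! Write `M` for the closed-loop matrix, `N` for the intensity of the noise entering the joint
state `(x, ξ)`, and `𝒬` for the weight of the running cost on that state. Variation of constants and
Fubini show that the second moments converge to the solution `X` of `M X + X Mᵀ + N = 0`, so the
cost is `tr (𝒬 X)` whatever the initial state (`Admissible.tendsto_averageCost`). The Lyapunov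
operator of a stable matrix is invertible, hence the cost is smooth on the open set of stabilizing
controllers (`ContDiffAt.lyapunovSol`). Non-summable steps then force the gradient to vanish at the
limit (`eq_zero_of_tendsto_descent`).

The remaining claim is algebraic: a minimal stationary controller is globally optimal. With the
adjoint solution `Y` of `Mᵀ Y + Y M + 𝒬 = 0`, stationarity is a set of three matrix equations in the
blocks of `X` and `Y`, obtained from the exact difference formula `Matrix.trace_lyapunov_sub`.
Controllability and observability of the controller make `X₂₂` and `Y₂₂` positive definite
(`Matrix.posDef_toBlocks₂₂_of_isControllable`), so `T = X₁₂ X₂₂⁻¹`, `U = Y₁₂ Y₂₂⁻¹` and the Schur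
complements `P` of `X`, `S` of `Y` exist. The equation for `A_K` says `Uᵀ T = -1`, the one for `B_K`
that `T B_K` is the Kalman gain of `P`, the one for `C_K` that `C_K = -F T` with `F = R⁻¹ Bᵀ S`.
Inserted in the Lyapunov equations, these give the filter and control Riccati equations for `P` and
`S` (`Matrix.riccati_of_lyapunov`).

Any such pair certifies a lower bound. Completing the square with `S` turns the cost of a
stabilizing controller into `tr (S W)` plus the stationary `R`-weighted second moment of `u + F x`,
and the filter equation shows that the closed-loop covariance dominates `diag (P, 0)`; so the cost
is at least `tr (S W) + tr (R F P Fᵀ)` (`Matrix.le_trace_cost_of_riccati`). The stationary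
controller attains this value. The pair comes from the stationary point itself, so no existence or
uniqueness theory for Riccati equations is needed. -/

theorem HasDerivAt.dotProduct' {ι : Type*} [Fintype ι] {f g : ℝ → ι → ℝ} {f' g' : ι → ℝ} {t : ℝ}
    (hf : HasDerivAt f f' t) (hg : HasDerivAt g g' t) :
    HasDerivAt (fun t => f t ⬝ᵥ g t) (f' ⬝ᵥ g t + f t ⬝ᵥ g') t := by
  have h := HasDerivAt.fun_sum (u := Finset.univ) fun i _ =>
    (hasDerivAt_pi.1 hf i).mul (hasDerivAt_pi.1 hg i)
  simpa only [dotProduct, Finset.sum_add_distrib] using! h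

theorem HasDerivAt.mulVec' {ι : Type*} [Fintype ι] (X : Matrix ι ι ℝ) {f : ℝ → ι → ℝ} {f' : ι → ℝ} {t : ℝ}
    (hf : HasDerivAt f f' t) : HasDerivAt (fun t => X *ᵥ f t) (X *ᵥ f') t :=
  (LinearMap.toContinuousLinearMap (Matrix.mulVecLin X)).hasFDerivAt.comp_hasDerivAt t hf

variable {ι : Type*} [Fintype ι] [DecidableEq ι]

theorem Matrix.hasSum_exp (M : Matrix ι ι ℂ) :
    HasSum (fun k : ℕ => ((k.factorial : ℂ)⁻¹) • M ^ k) (NormedSpace.exp M) := by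
  open scoped Matrix.Norms.Operator in
  exact NormedSpace.exp_series_hasSum_exp' (𝕂 := ℂ) M

theorem Matrix.exp_smul_one (z : ℂ) :
    NormedSpace.exp (z • (1 : Matrix ι ι ℂ)) = Complex.exp z • 1 := by
  have h : NormedSpace.exp (algebraMap ℂ (Matrix ι ι ℂ) z)
      = algebraMap ℂ (Matrix ι ι ℂ) (NormedSpace.exp z) := by
    open scoped Matrix.Norms.Operator in
    exact (NormedSpace.algebraMap_exp_comm (𝕂 := ℂ) (𝔸 := Matrix ι ι ℂ) z).symm
  rw [← Algebra.algebraMap_eq_smul_one, ← Algebra.algebraMap_eq_smul_one, h, Complex.exp_eq_exp_ℂ]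

theorem Matrix.exp_map_ofReal (M : Matrix ι ι ℝ) :
    NormedSpace.exp (M.map (fun r : ℝ => (r : ℂ))) =
      (NormedSpace.exp M).map (fun r : ℝ => (r : ℂ)) := by
  open scoped Matrix.Norms.Operator in
  exact (NormedSpace.map_exp (Complex.ofRealHom.mapMatrix : Matrix ι ι ℝ →+* Matrix ι ι ℂ)
    (Continuous.matrix_map continuous_id Complex.continuous_ofReal) M).symm

theorem Matrix.hasDerivAt_vecMul_exp (M : Matrix ι ι ℝ) (c : ι → ℝ) (t : ℝ) :
    HasDerivAt (fun t : ℝ => c ᵥ* NormedSpace.exp (t • M))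
      ((c ᵥ* NormedSpace.exp (t • M)) ᵥ* M) t := by
  open scoped Matrix.Norms.Operator in
  have h : HasDerivAt (fun u : ℝ => NormedSpace.exp (u • M)) (NormedSpace.exp (t • M) * M) t :=
    hasDerivAt_exp_smul_const M t
  rw [Matrix.vecMul_vecMul]
  exact ((LinearMap.toContinuousLinearMap
    (Matrix.vecMulBilin ℝ ℝ c)).hasFDerivAt.comp_hasDerivAt t h)

theorem tendsto_exp_mul_pow_zero {μ : ℂ} (hμ : μ.re < 0) (j : ℕ) :
    Tendsto (fun t : ℝ => Complex.exp (t * μ) * (t : ℂ) ^ j) atTop (𝓝 0) := by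
  rw [tendsto_zero_iff_norm_tendsto_zero]
  have h := tendsto_rpow_mul_exp_neg_mul_atTop_nhds_zero j (-μ.re) (by linarith)
  refine h.congr' ?_
  filter_upwards [eventually_ge_atTop 0] with t ht
  simp [Complex.norm_exp, abs_of_nonneg ht, mul_comm]

/-- Split `M` into the scalar part `μ` and `M - μ`, which commute. On a generalized eigenvector the
exponential series of `t (M - μ)` stops after `k` terms. -/
theorem Matrix.exp_smul_mulVec_of_pow_eq_zero (M : Matrix ι ι ℂ) (μ : ℂ) (k : ℕ) (v : ι → ℂ)
    (hv : ((M - μ • (1 : Matrix ι ι ℂ)) ^ k) *ᵥ v = 0) (t : ℂ) :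
    NormedSpace.exp (t • M) *ᵥ v = ∑ j ∈ Finset.range k, (Complex.exp (t * μ) * t ^ j) •
      (((j.factorial : ℂ)⁻¹) • ((M - μ • (1 : Matrix ι ι ℂ)) ^ j *ᵥ v)) := by
  set N := M - μ • (1 : Matrix ι ι ℂ) with hN
  have hM : t • M = (t * μ) • (1 : Matrix ι ι ℂ) + t • N := by
    rw [hN, smul_sub, smul_smul]; abel
  have hcomm : Commute ((t * μ) • (1 : Matrix ι ι ℂ)) (t • N) :=
    ((Commute.one_left _).smul_left _)
  rw [hM, Matrix.exp_add_of_commute _ _ hcomm, Matrix.exp_smul_one, smul_mul_assoc, one_mul, Matrix.smul_mulVec]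
  have hs := Matrix.hasSum_exp (t • N)
  have hs2 : HasSum (fun n : ℕ => (((n.factorial : ℂ)⁻¹) • (t • N) ^ n) *ᵥ v)
      (NormedSpace.exp (t • N) *ᵥ v) := by
    let f : Matrix ι ι ℂ →ₗ[ℂ] (ι → ℂ) := (Matrix.mulVecBilin ℂ ℂ).flip v
    exact hs.mapL (LinearMap.toContinuousLinearMap f)
  have hz : ∀ n ∉ Finset.range k, (((n.factorial : ℂ)⁻¹) • (t • N) ^ n) *ᵥ v = 0 := by
    intro n hn
    have hkn : k ≤ n := by simpa using hn
    obtain ⟨l, rfl⟩ := Nat.exists_eq_add_of_le' hkn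
    rw [smul_pow, pow_add, pow_add, Matrix.smul_mulVec, Matrix.smul_mulVec, ← Matrix.mulVec_mulVec,
      hv, Matrix.mulVec_zero, smul_zero, smul_zero]
  rw [hs2.unique (hasSum_sum_of_ne_finset_zero hz), Finset.smul_sum]
  refine Finset.sum_congr rfl fun j _ => ?_
  rw [smul_pow, Matrix.smul_mulVec, Matrix.smul_mulVec, smul_smul, smul_smul, smul_smul]
  congr 1; ring

/-- The vectors whose trajectory under the semigroup of `M` tends to zero. -/
def Matrix.decayingSubmodule (M : Matrix ι ι ℂ) : Submodule ℂ (ι → ℂ) where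
  carrier := {v | Tendsto (fun t : ℝ => NormedSpace.exp ((t : ℂ) • M) *ᵥ v) atTop (𝓝 0)}
  add_mem' := by
    intro a b ha hb
    simpa [Matrix.mulVec_add] using ha.add hb
  zero_mem' := by simp
  smul_mem' := by
    intro c a ha
    simpa [Matrix.mulVec_smul] using ha.const_smul c

/-- Over `ℂ` the generalized eigenspaces span, and on each of them a trajectory is a finite sum of
terms `exp (t μ) t ^ j` with `re μ < 0`. -/
theorem Matrix.decayingSubmodule_eq_top (M : Matrix ι ι ℂ) (hM : ∀ μ ∈ spectrum ℂ M, μ.re < 0) :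
    M.decayingSubmodule = ⊤ := by
  rw [eq_top_iff, ← Module.End.iSup_maxGenEigenspace_eq_top (Matrix.toLin' M)]
  refine iSup_le fun μ v hv => ?_
  by_cases hv0 : v = 0
  · rw [hv0]; exact zero_mem _
  have hpow : ∀ k : ℕ, ((Matrix.toLin' M - μ • (1 : Module.End ℂ (ι → ℂ))) ^ k) v
      = ((M - μ • (1 : Matrix ι ι ℂ)) ^ k) *ᵥ v := by
    intro k
    rw [← Matrix.toLin'_apply, Matrix.toLin'_pow, map_sub, map_smul, Matrix.toLin'_one]
    rfl
  -- A generalized eigenspace containing a nonzero vector belongs to a genuine eigenvalue.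
  have hμ : μ ∈ spectrum ℂ M := by
    rw [← Matrix.spectrum_toLin', ← Module.End.hasEigenvalue_iff_mem_spectrum]
    by_contra hne
    have : Module.End.maxGenEigenspace (Matrix.toLin' M) μ = ⊥ := by
      by_contra hb
      apply hne
      exact Module.End.hasUnifEigenvalue_iff_hasUnifEigenvalue_one (k := ⊤) (by simp) |>.1 hb
    rw [this] at hv
    exact hv0 (by simpa using hv)
  obtain ⟨k, hk⟩ := (Module.End.mem_maxGenEigenspace _ _ _).1 hv
  rw [hpow] at hk
  change Tendsto _ _ _
  simp_rw [Matrix.exp_smul_mulVec_of_pow_eq_zero M μ k v hk]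
  rw [show (0 : ι → ℂ) = ∑ j ∈ Finset.range k, (0 : ℂ) •
    (((j.factorial : ℂ)⁻¹) • ((M - μ • (1 : Matrix ι ι ℂ)) ^ j *ᵥ v)) by simp]
  exact tendsto_finsetSum _ fun j _ => (tendsto_exp_mul_pow_zero (hM μ hμ) j).smul_const _

theorem IsStableMatrix.tendsto_exp {M : Matrix ι ι ℝ} (hM : IsStableMatrix M) :
    Tendsto (fun t : ℝ => NormedSpace.exp (t • M)) atTop (𝓝 0) := by
  have hmap : ∀ t : ℝ, NormedSpace.exp ((t : ℂ) • M.map (fun r : ℝ => (r : ℂ)))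
      = (NormedSpace.exp (t • M)).map (fun r : ℝ => (r : ℂ)) := by
    intro t
    rw [← Matrix.exp_map_ofReal]
    congr 1
    ext i j; simp
  refine tendsto_pi_nhds.2 fun i => tendsto_pi_nhds.2 fun j => ?_
  have h := (Matrix.decayingSubmodule_eq_top _ hM).ge (Submodule.mem_top (x := Pi.single j (1 : ℂ)))
  have h' : Tendsto (fun t : ℝ => NormedSpace.exp ((t : ℂ) • M.map (fun r : ℝ => (r : ℂ)))
    *ᵥ Pi.single j (1 : ℂ)) atTop (𝓝 0) := h
  rw [tendsto_pi_nhds] at h'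
  have h2 := (Complex.continuous_re.tendsto _).comp (h' i)
  refine (h2.congr fun t => ?_)
  simp only [Function.comp, hmap t]
  simp

/-- Upper hemicontinuity of the spectrum: a spectrum contained in the open left half-plane stays
there under small perturbations. -/
theorem isOpen_setOf_isStableMatrix : IsOpen {M : Matrix ι ι ℝ | IsStableMatrix M} := by
  open scoped Matrix.Norms.Operator in
  have h := upperHemicontinuous_spectrum ℂ (Matrix ι ι ℂ)
  have hc : Continuous (fun M : Matrix ι ι ℝ => M.map (fun r : ℝ => (r : ℂ))) :=
    Continuous.matrix_map continuous_id Complex.continuous_ofReal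
  have ho : IsOpen {z : ℂ | z.re < 0} := isOpen_lt Complex.continuous_re continuous_const
  refine isOpen_iff_mem_nhds.2 fun M hM => ?_
  exact hc.continuousAt.eventually (upperHemicontinuous_iff_forall_isOpen.1 h _ _ ho hM)

/-- Along the semigroup, differentiating the form of `X` applies the Lyapunov operator to `X`.
Uniqueness, positivity and the covariance formula all come from this identity. -/
theorem Matrix.hasDerivAt_exp_bilin (M X : Matrix ι ι ℝ) (c d : ι → ℝ) (t : ℝ) :
    HasDerivAt (fun t : ℝ => (c ᵥ* NormedSpace.exp (t • M)) ⬝ᵥ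
        (X *ᵥ (d ᵥ* NormedSpace.exp (t • M))))
      ((c ᵥ* NormedSpace.exp (t • M)) ⬝ᵥ
        ((M * X + X * Mᵀ) *ᵥ (d ᵥ* NormedSpace.exp (t • M)))) t := by
  convert (M.hasDerivAt_vecMul_exp c t).dotProduct' ((M.hasDerivAt_vecMul_exp d t).mulVec' X) using 1
  rw [Matrix.add_mulVec, dotProduct_add, ← Matrix.mulVec_mulVec, ← Matrix.mulVec_mulVec,
    Matrix.mulVec_transpose, Matrix.dotProduct_mulVec _ M]

theorem IsStableMatrix.tendsto_vecMul_exp {M : Matrix ι ι ℝ} (hM : IsStableMatrix M) (c : ι → ℝ) :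
    Tendsto (fun t : ℝ => c ᵥ* NormedSpace.exp (t • M)) atTop (𝓝 0) := by
  have h : Continuous fun E : Matrix ι ι ℝ => c ᵥ* E := continuous_const.matrix_vecMul continuous_id
  simpa [Function.comp_def] using (h.tendsto 0).comp hM.tendsto_exp

theorem IsStableMatrix.tendsto_exp_bilin {M : Matrix ι ι ℝ} (hM : IsStableMatrix M)
    (X : Matrix ι ι ℝ) (c d : ι → ℝ) :
    Tendsto (fun t : ℝ => (c ᵥ* NormedSpace.exp (t • M)) ⬝ᵥ
        (X *ᵥ (d ᵥ* NormedSpace.exp (t • M)))) atTop (𝓝 0) := by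
  have h : Continuous fun p : (ι → ℝ) × (ι → ℝ) => p.1 ⬝ᵥ (X *ᵥ p.2) := by fun_prop
  simpa [Function.comp_def] using (h.tendsto 0).comp ((hM.tendsto_vecMul_exp c).prodMk_nhds (hM.tendsto_vecMul_exp d))

/-- The Lyapunov operator `X ↦ M X + X Mᵀ`. -/
def Matrix.lyapunov (M : Matrix ι ι ℝ) : Matrix ι ι ℝ →ₗ[ℝ] Matrix ι ι ℝ :=
  LinearMap.mulLeft ℝ M + LinearMap.mulRight ℝ Mᵀ

@[simp] theorem Matrix.lyapunov_apply (M X : Matrix ι ι ℝ) : M.lyapunov X = M * X + X * Mᵀ := rfl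

/-- For `X` in the kernel the form of `X` is constant along the semigroup, while stability makes it
tend to zero. -/
theorem IsStableMatrix.lyapunov_injective {M : Matrix ι ι ℝ} (hM : IsStableMatrix M) :
    Function.Injective M.lyapunov := by
  rw [injective_iff_map_eq_zero]
  intro X hX
  rw [Matrix.lyapunov_apply] at hX
  have key : ∀ c d : ι → ℝ, c ⬝ᵥ (X *ᵥ d) = 0 := by
    intro c d
    have hd : ∀ t, HasDerivAt (fun t : ℝ => (c ᵥ* NormedSpace.exp (t • M)) ⬝ᵥ
        (X *ᵥ (d ᵥ* NormedSpace.exp (t • M)))) 0 t := fun t => by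
      simpa [hX] using M.hasDerivAt_exp_bilin X c d t
    have hconst := fun t => is_const_of_deriv_eq_zero
      (fun t => (hd t).differentiableAt) (fun t => (hd t).deriv) t 0
    have h := (hM.tendsto_exp_bilin X c d)
    simp only [hconst] at h
    simpa using tendsto_nhds_unique tendsto_const_nhds h
  ext i j
  simpa using key (Pi.single i 1) (Pi.single j 1)

theorem IsStableMatrix.lyapunov_bijective {M : Matrix ι ι ℝ} (hM : IsStableMatrix M) :
    Function.Bijective M.lyapunov :=
  ⟨hM.lyapunov_injective, LinearMap.injective_iff_surjective.1 hM.lyapunov_injective⟩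

theorem IsStableMatrix.isSymm_of_lyapunov {M X N : Matrix ι ι ℝ} (hM : IsStableMatrix M)
    (hN : Nᵀ = N) (hX : M * X + X * Mᵀ + N = 0) : Xᵀ = X := by
  apply hM.lyapunov_injective
  have h := congrArg Matrix.transpose hX
  simp only [Matrix.transpose_add, Matrix.transpose_mul, Matrix.transpose_transpose, hN,
    Matrix.transpose_zero] at h
  rw [Matrix.lyapunov_apply, Matrix.lyapunov_apply, eq_neg_of_add_eq_zero_left hX, ← 
    eq_neg_of_add_eq_zero_left h, add_comm]

/-- The quadratic form of `X` along the semigroup has derivative minus that of `N`, so it decreases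
to its limit zero and is nonnegative at time zero. -/
theorem IsStableMatrix.posSemidef_of_lyapunov {M X N : Matrix ι ι ℝ} (hM : IsStableMatrix M)
    (hN : N.PosSemidef) (hX : M * X + X * Mᵀ + N = 0) : X.PosSemidef := by
  have hN' : Nᵀ = N := hN.isHermitian
  refine Matrix.PosSemidef.of_dotProduct_mulVec_nonneg (hM.isSymm_of_lyapunov hN' hX) fun c => ?_
  have hd := M.hasDerivAt_exp_bilin X c c
  have hanti : Antitone (fun t : ℝ => (c ᵥ* NormedSpace.exp (t • M)) ⬝ᵥ
        (X *ᵥ (c ᵥ* NormedSpace.exp (t • M)))) := by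
    refine antitone_of_deriv_nonpos (fun t => (hd t).differentiableAt) fun t => ?_
    rw [(hd t).deriv, eq_neg_of_add_eq_zero_left hX, Matrix.neg_mulVec, dotProduct_neg]
    exact neg_nonpos.2 (hN.dotProduct_mulVec_nonneg _)
  simpa using hanti.le_of_tendsto (hM.tendsto_exp_bilin X c c) 0

theorem IsStableMatrix.transpose {M : Matrix ι ι ℝ} (hM : IsStableMatrix M) :
    IsStableMatrix Mᵀ := by
  intro μ hμ
  apply hM μ
  rw [Matrix.transpose_map, spectrum.mem_iff] at hμ
  rw [spectrum.mem_iff]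
  contrapose! hμ
  rw [← Matrix.isUnit_transpose] at hμ
  simpa [Algebra.algebraMap_eq_smul_one, Matrix.transpose_sub] using hμ

end Stability

/-! ### Path regularity and second moments of Wiener processes. -/

section Wiener

/-- A process with measurable marginals and almost surely continuous paths has a version, equal to
it up to a null set, with measurable marginals and continuous paths. -/
theorem exists_continuous_measurable_version {T Ω E : Type*} [TopologicalSpace T]
    [FirstCountableTopology T] [TopologicalSpace.SeparableSpace T] [Nonempty T]
    [MeasurableSpace Ω] {P : Measure Ω} [TopologicalSpace E] [TopologicalSpace.PseudoMetrizableSpace E]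
    [MeasurableSpace E] [BorelSpace E] [Zero E] {X : T → Ω → E} (hX : ∀ t, AEMeasurable (X t) P)
    (hc : ∀ᵐ ω ∂P, Continuous fun t => X t ω) :
    ∃ Y : T → Ω → E, (∀ t, Measurable (Y t)) ∧ (∀ ω, Continuous fun t => Y t ω) ∧
      ∀ᵐ ω ∂P, ∀ t, Y t ω = X t ω := by
  classical
  let q := TopologicalSpace.denseSeq T
  have hq : ∀ᵐ ω ∂P, (Continuous fun t => X t ω) ∧ ∀ k, X (q k) ω = (hX (q k)).mk _ ω :=
    hc.and (ae_all_iff.2 fun k => (hX (q k)).ae_eq_mk)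
  -- A measurable set of full measure on which the path is continuous and agrees with measurable
  -- modifications at all times of a dense sequence.
  set A := (toMeasurable P {ω | ¬ ((Continuous fun t => X t ω) ∧
    ∀ k, X (q k) ω = (hX (q k)).mk _ ω)})ᶜ with hA
  have hAm : MeasurableSet A := (measurableSet_toMeasurable _ _).compl
  have hAP : ∀ᵐ ω ∂P, ω ∈ A := by
    rw [ae_iff]
    simp only [hA, Set.mem_compl_iff, not_not, Set.ofPred_mem_eq, measure_toMeasurable]
    exact ae_iff.1 hq
  have hAgood : ∀ ω ∈ A, (Continuous fun t => X t ω) ∧ ∀ k, X (q k) ω = (hX (q k)).mk _ ω := by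
    intro ω hω
    by_contra h
    exact hω (subset_toMeasurable _ _ h)
  have hcont : ∀ ω, Continuous fun t => A.indicator (X t) ω := by
    intro ω
    by_cases hω : ω ∈ A
    · simpa [hω] using (hAgood ω hω).1
    · simpa [hω] using continuous_const
  refine ⟨fun t => A.indicator (X t), fun t => ?_, hcont, ?_⟩
  -- Continuity of the paths carries measurability from the dense times to every `t`.
  · obtain ⟨s, hs, hst⟩ := mem_closure_iff_seq_limit.1
      ((TopologicalSpace.denseRange_denseSeq T) t)
    choose k hk using hs
    refine measurable_of_tendsto_metrizable (f := fun j => A.indicator (X (s j))) (fun j => ?_)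
      (tendsto_pi_nhds.2 fun ω => ((hcont ω).tendsto t).comp hst)
    rw [← hk j, Set.indicator_congr (fun ω hω => (hAgood ω hω).2 (k j))]
    exact (hX (q (k j))).measurable_mk.indicator hAm
  · filter_upwards [hAP] with ω hω t
    simp [hω]

variable {Ω : Type*} [MeasurableSpace Ω] {P : Measure Ω} {d : ℕ}
  {Sig : Matrix (Fin d) (Fin d) ℝ} {X : ℝ≥0 → Ω → EuclideanSpace ℝ (Fin d)}

theorem IsWienerProcess.hasLaw_eval (h : IsWienerProcess Sig X P) (t : ℝ≥0) :
    HasLaw (X t) (multivariateGaussian 0 ((t : ℝ) • Sig)) P := by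
  have h1 := h.law_increments 0 t zero_le
  simp only [NNReal.coe_zero, sub_zero] at h1
  refine h1.congr ?_
  filter_upwards [h.start_zero] with ω hω
  simp [hω]

theorem memLp_eval_multivariateGaussian (S : Matrix (Fin d) (Fin d) ℝ) (i : Fin d) :
    MemLp (fun x : EuclideanSpace ℝ (Fin d) => x i) 2 (multivariateGaussian 0 S) :=
  (IsGaussian.memLp_two_id (μ := multivariateGaussian 0 S)).continuousLinearMap_comp
    (EuclideanSpace.proj (𝕜 := ℝ) i)

theorem integral_eval_multivariateGaussian (S : Matrix (Fin d) (Fin d) ℝ) (i : Fin d) :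
    ∫ x : EuclideanSpace ℝ (Fin d), x i ∂(multivariateGaussian 0 S) = 0 := by
  have := (EuclideanSpace.proj (𝕜 := ℝ) i).integral_comp_id_comm
    (μ := multivariateGaussian 0 S) IsGaussian.integrable_id
  simpa using this

theorem IsWienerProcess.memLp (h : IsWienerProcess Sig X P) (t : ℝ≥0) (i : Fin d) :
    MemLp (fun ω => X t ω i) 2 P := by
  have h1 := h.hasLaw_eval t
  have h2 := memLp_eval_multivariateGaussian ((t : ℝ) • Sig) i
  rw [← h1.map_eq] at h2
  exact h2.comp_of_map h1.aemeasurable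

theorem IsWienerProcess.integral_eval (h : IsWienerProcess Sig X P) (t : ℝ≥0) (i : Fin d) :
    ∫ ω, X t ω i ∂P = 0 := by
  rw [← integral_eval_multivariateGaussian ((t : ℝ) • Sig) i]
  exact (h.hasLaw_eval t).integral_comp (f := fun x : EuclideanSpace ℝ (Fin d) => x i)
    (by fun_prop)

theorem IsWienerProcess.integral_mul_self (h : IsWienerProcess Sig X P) (hS : Sig.PosSemidef)
    (t : ℝ≥0) (i j : Fin d) : ∫ ω, X t ω i * X t ω j ∂P = t * Sig i j := by
  have h1 := covariance_eval_multivariateGaussian (μ := 0) (hS.smul t.2) i j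
  rw [covariance_eq_sub (memLp_eval_multivariateGaussian _ i) (memLp_eval_multivariateGaussian _ j),
    integral_eval_multivariateGaussian, zero_mul, sub_zero] at h1
  have h2 := (h.hasLaw_eval t).integral_comp
    (f := fun x : EuclideanSpace ℝ (Fin d) => x i * x j) (by fun_prop)
  refine h2.trans (Eq.trans ?_ h1)
  rfl

/-- The increment from `s` to `t` is independent of the centred variable `X s`, so only the second
moment at time `s` survives. -/
theorem IsWienerProcess.integral_mul_of_le (h : IsWienerProcess Sig X P) (hS : Sig.PosSemidef)
    {s t : ℝ≥0} (hst : s ≤ t) (i j : Fin d) : ∫ ω, X s ω i * X t ω j ∂P = s * Sig i j := by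
  have hind := h.indep_increments.indepFun_eval_sub zero_le hst h.start_zero
  have hind' : IndepFun (fun ω => X s ω i) (fun ω => X t ω j - X s ω j) P :=
    hind.comp (φ := fun x : EuclideanSpace ℝ (Fin d) => x i)
      (ψ := fun x : EuclideanSpace ℝ (Fin d) => x j) (by fun_prop) (by fun_prop)
  have hm := hind'.integral_fun_mul_eq_mul_integral (h.memLp s i).aestronglyMeasurable
    ((h.memLp t j).sub (h.memLp s j)).aestronglyMeasurable
  rw [h.integral_eval, zero_mul] at hm
  have hi1 : Integrable (fun ω => X s ω i * X s ω j) P := (h.memLp s i).integrable_mul (h.memLp s j)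
  have hi2 : Integrable (fun ω => X s ω i * (X t ω j - X s ω j)) P :=
    (h.memLp s i).integrable_mul ((h.memLp t j).sub (h.memLp s j))
  rw [← h.integral_mul_self hS s i j, ← add_zero (∫ ω, X s ω i * X s ω j ∂P), ← hm,
    ← integral_add hi1 hi2]
  congr 1; ext ω; ring

theorem IsWienerProcess.integral_mul (h : IsWienerProcess Sig X P) (hS : Sig.PosSemidef)
    (s t : ℝ≥0) (i j : Fin d) : ∫ ω, X s ω i * X t ω j ∂P = min (s : ℝ) t * Sig i j := by
  rcases le_total s t with hst | hst
  · rw [h.integral_mul_of_le hS hst, min_eq_left (by exact_mod_cast hst)]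
  · simp_rw [mul_comm (X s _ i)]
    rw [h.integral_mul_of_le hS hst, min_eq_right (by exact_mod_cast hst)]
    have : Sigᵀ = Sig := hS.isHermitian
    rw [← congrFun (congrFun this j) i, Matrix.transpose_apply]

end Wiener

/-! ### The joint noise driving plant and controller states. -/

section Noise

variable {Ω : Type*} [MeasurableSpace Ω] {ι : Type*}

/-- A square-integrable process with continuous paths from `0` and the second moments of a Wiener
process with intensity `Sig`. -/
structure IsNoise (N : ℝ → Ω → ι → ℝ) (Sig : Matrix ι ι ℝ) (P : Measure Ω) : Prop where
  measurable : ∀ t i, Measurable fun ω => N t ω i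
  continuous : ∀ ω i, Continuous fun t => N t ω i
  memLp : ∀ t i, MemLp (fun ω => N t ω i) 2 P
  cov : ∀ s t : ℝ, 0 ≤ s → 0 ≤ t → ∀ i j, ∫ ω, N s ω i * N t ω j ∂P = min s t * Sig i j

theorem IsNoise.measurable_uncurry {N : ℝ → Ω → ι → ℝ} {Sig : Matrix ι ι ℝ} {P : Measure Ω}
    (h : IsNoise N Sig P) (i : ι) : Measurable (Function.uncurry fun t ω => N t ω i) :=
  measurable_uncurry_of_continuous_of_measurable (fun ω => h.continuous ω i) fun t => h.measurable t i

/-- The closed loop is driven by the stacked noise `(w, B_K v)`; its cross moments vanish because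
`w` and `v` are independent and centred. Only continuity and second moments are kept, since nothing
else about the noise enters the cost. -/
theorem exists_isNoise_of_isWienerProcess {P : Measure Ω} [IsProbabilityMeasure P] {n p : ℕ}
    {W : Matrix (Fin n) (Fin n) ℝ} {V : Matrix (Fin p) (Fin p) ℝ}
    (hWp : W.PosSemidef) (hVp : V.PosSemidef)
    {w : ℝ≥0 → Ω → EuclideanSpace ℝ (Fin n)} {v : ℝ≥0 → Ω → EuclideanSpace ℝ (Fin p)}
    (hw : IsWienerProcess W w P) (hv : IsWienerProcess V v P)
    (hwv : IndepFun (fun ω t => w t ω) (fun ω t => v t ω) P) (BK : Matrix (Fin n) (Fin p) ℝ) :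
    ∃ N : ℝ → Ω → Fin n ⊕ Fin n → ℝ,
      IsNoise N (Matrix.fromBlocks W 0 0 (BK * V * BKᵀ)) P ∧
      ∀ᵐ ω ∂P, ∀ t : ℝ≥0, N t ω = Sum.elim (w t ω).ofLp (BK *ᵥ (v t ω).ofLp) := by
  obtain ⟨w', hw'm, hw'c, hw'⟩ := exists_continuous_measurable_version
    (fun t => (hw.hasLaw_eval t).aemeasurable) hw.continuous_paths
  obtain ⟨v', hv'm, hv'c, hv'⟩ := exists_continuous_measurable_version
    (fun t => (hv.hasLaw_eval t).aemeasurable) hv.continuous_paths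
  have hwi : ∀ t i, (fun ω => w t ω i) =ᵐ[P] fun ω => w' t ω i := fun t i => by
    filter_upwards [hw'] with ω h using by rw [h]
  have hvi : ∀ t i, (fun ω => v t ω i) =ᵐ[P] fun ω => v' t ω i := fun t i => by
    filter_upwards [hv'] with ω h using by rw [h]
  have lw : ∀ t i, MemLp (fun ω => w' t ω i) 2 P := fun t i => (hw.memLp t i).ae_eq (hwi t i)
  have lv : ∀ t i, MemLp (fun ω => v' t ω i) 2 P := fun t i => (hv.memLp t i).ae_eq (hvi t i)
  have cw : ∀ s t i j, ∫ ω, w' s ω i * w' t ω j ∂P = min (s : ℝ) t * W i j := fun s t i j => by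
    rw [← hw.integral_mul hWp s t i j]
    exact integral_congr_ae ((hwi s i).mul (hwi t j)).symm
  have cv : ∀ s t i j, ∫ ω, v' s ω i * v' t ω j ∂P = min (s : ℝ) t * V i j := fun s t i j => by
    rw [← hv.integral_mul hVp s t i j]
    exact integral_congr_ae ((hvi s i).mul (hvi t j)).symm
  have cwv : ∀ s t i j, ∫ ω, w' s ω i * v' t ω j ∂P = 0 := fun s t i j => by
    have hind : IndepFun (fun ω => w s ω i) (fun ω => v t ω j) P :=
      hwv.comp (φ := fun f : ℝ≥0 → EuclideanSpace ℝ (Fin n) => f s i)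
        (ψ := fun f : ℝ≥0 → EuclideanSpace ℝ (Fin p) => f t j) (by fun_prop) (by fun_prop)
    have hm := hind.integral_fun_mul_eq_mul_integral (hw.memLp s i).aestronglyMeasurable
      (hv.memLp t j).aestronglyMeasurable
    rw [hw.integral_eval, zero_mul] at hm
    rw [← hm]
    exact integral_congr_ae ((hwi s i).mul (hvi t j)).symm
  have iwv : ∀ s t i j, Integrable (fun ω => w' s ω i * v' t ω j) P := fun s t i j =>
    (lw s i).integrable_mul (lv t j)
  have ivv : ∀ s t i j, Integrable (fun ω => v' s ω i * v' t ω j) P := fun s t i j =>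
    (lv s i).integrable_mul (lv t j)
  have cwB : ∀ s t i j, ∫ ω, w' s ω i * (BK *ᵥ (v' t ω).ofLp) j ∂P = 0 := fun s t i j => by
    simp only [Matrix.mulVec, dotProduct, Finset.mul_sum]
    rw [integral_finsetSum _ fun k _ => by
      simpa only [mul_left_comm] using (iwv s t i k).const_mul (BK j k)]
    refine Finset.sum_eq_zero fun k _ => ?_
    simp only [mul_left_comm _ (BK j k), integral_const_mul, cwv, mul_zero]
  -- `toNNReal` freezes the process at its time-zero value for negative times, which keeps the paths
  -- continuous on all of `ℝ`.
  refine ⟨fun t ω => Sum.elim (w' t.toNNReal ω).ofLp (BK *ᵥ (v' t.toNNReal ω).ofLp),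
    ⟨?_, ?_, ?_, ?_⟩, ?_⟩
  · rintro t (i | i)
    · simp only [Sum.elim_inl]; have := hw'm t.toNNReal; fun_prop
    · simp only [Sum.elim_inr, Matrix.mulVec, dotProduct]; have := hv'm t.toNNReal; fun_prop
  · rintro ω (i | i)
    · simp only [Sum.elim_inl]; have := hw'c ω; fun_prop
    · simp only [Sum.elim_inr, Matrix.mulVec, dotProduct]; have := hv'c ω; fun_prop
  · rintro t (i | i)
    · exact lw _ i
    · simp only [Sum.elim_inr, Matrix.mulVec, dotProduct]
      exact memLp_finsetSum _ fun k _ => (lv _ k).const_mul _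
  · rintro s t hs ht (i | i) (j | j)
    · simp [cw, hs, ht]
    · simp [cwB]
    · simp only [Sum.elim_inl, Sum.elim_inr, mul_comm _ (w' _ _ j), cwB]
      simp
    · simp only [Sum.elim_inr, Matrix.mulVec, dotProduct, Matrix.fromBlocks_apply₂₂,
        Finset.sum_mul_sum]
      have hi : ∀ k l, Integrable (fun ω => BK i k * (v' s.toNNReal ω).ofLp k *
          (BK j l * (v' t.toNNReal ω).ofLp l)) P := fun k l => by
        refine ((ivv s.toNNReal t.toNNReal k l).const_mul (BK i k * BK j l)).congr
          (ae_of_all _ fun ω => ?_)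
        simp only
        ring
      rw [integral_finsetSum _ fun k _ => integrable_finsetSum _ fun l _ => hi k l]
      simp only [integral_finsetSum _ fun l _ => hi _ l, Matrix.mul_apply, Finset.sum_mul,
        Finset.mul_sum, Matrix.transpose_apply]
      rw [Finset.sum_comm]
      refine Finset.sum_congr rfl fun l _ => Finset.sum_congr rfl fun k _ => ?_
      have hc := cv s.toNNReal t.toNNReal k l
      rw [Real.coe_toNNReal _ hs, Real.coe_toNNReal _ ht] at hc
      rw [show min s t * (BK i k * V k l * BK j l) = BK i k * BK j l * (min s t * V k l) by ring,
        ← hc, ← integral_const_mul]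
      congr 1
      ext ω
      ring
  · filter_upwards [hw', hv'] with ω h1 h2 t
    simp [h1, h2]

end Noise

/-! ### Pathwise variation of constants. -/

section Deterministic

variable {ι : Type*} [Fintype ι] [DecidableEq ι]

theorem Matrix.hasDerivAt_vecMul_exp_sub (M : Matrix ι ι ℝ) (c : ι → ℝ) (t s : ℝ) :
    HasDerivAt (fun s : ℝ => c ᵥ* NormedSpace.exp ((t - s) • M))
      (-((c ᵥ* NormedSpace.exp ((t - s) • M)) ᵥ* M)) s := by
  have h := (M.hasDerivAt_vecMul_exp c (t - s)).scomp s ((hasDerivAt_id s).const_sub t)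
  simpa [Function.comp_def] using h

theorem Matrix.continuous_vecMul_exp (M : Matrix ι ι ℝ) (c : ι → ℝ) :
    Continuous (fun s : ℝ => c ᵥ* NormedSpace.exp (s • M)) :=
  continuous_iff_continuousAt.2 fun s => (M.hasDerivAt_vecMul_exp c s).continuousAt

/-- Variation of constants for `z(t) = z(0) + ∫₀ᵗ M z + ν(t)`. -/
theorem Matrix.variation_of_constants (M : Matrix ι ι ℝ) {z ν : ℝ → ι → ℝ}
    (hz : ContinuousOn z (Set.Ici 0))
    (h : ∀ t, 0 ≤ t → z t = z 0 + (∫ s in (0 : ℝ)..t, M *ᵥ z s) + ν t) (c : ι → ℝ) {t : ℝ}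
    (ht : 0 ≤ t) :
    c ⬝ᵥ z t = (c ᵥ* NormedSpace.exp (t • M)) ⬝ᵥ z 0 + (c ⬝ᵥ ν t +
      ∫ s in (0 : ℝ)..t, ((c ᵥ* NormedSpace.exp ((t - s) • M)) ᵥ* M) ⬝ᵥ ν s) := by
  -- The differentiable part `z - ν` of the path; `max s 0` extends `z` continuously to negative
  -- times.
  set y : ℝ → ι → ℝ := fun t => z 0 + ∫ s in (0 : ℝ)..t, M *ᵥ z (max s 0) with hy
  have hzc : Continuous fun s => z (max s 0) :=
    hz.comp_continuous (by fun_prop) fun s => Set.mem_Ici.2 (le_max_right _ _)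
  have hMz : Continuous fun s => M *ᵥ z (max s 0) := continuous_const.matrix_mulVec hzc
  have hyd : ∀ s, HasDerivAt y (M *ᵥ z (max s 0)) s := fun s =>
    (hMz.integral_hasStrictDerivAt 0 s).hasDerivAt.const_add (z 0)
  have hyz : ∀ s, 0 ≤ s → z s = y s + ν s := by
    intro s hs
    rw [h s hs, hy]
    congr 2
    refine intervalIntegral.integral_congr fun r hr => ?_
    rw [Set.uIcc_of_le hs] at hr
    simp [max_eq_left hr.1]
  -- The derivative of `c exp ((t - s) M) ⬝ y s` reduces to `c exp ((t - s) M) M ⬝ ν s`, because `z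
  -- - y = ν`. The noise is never differentiated, so no stochastic integral is needed.
  have hd := fun s => (M.hasDerivAt_vecMul_exp_sub c t s).dotProduct' (hyd s)
  have hint := intervalIntegral.integral_eq_sub_of_hasDerivAt (a := 0) (b := t)
    (fun s _ => hd s) (by
      refine Continuous.intervalIntegrable ?_ _ _
      have h1 : Continuous fun s : ℝ => c ᵥ* NormedSpace.exp ((t - s) • M) :=
        (M.continuous_vecMul_exp c).comp (continuous_const.sub continuous_id)
      have h2 : Continuous y := continuous_iff_continuousAt.2 fun s => (hyd s).continuousAt
      exact ((h1.matrix_vecMul continuous_const).neg.dotProduct h2).add (h1.dotProduct hMz))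
  have hcongr : (∫ s in (0 : ℝ)..t, (-((c ᵥ* NormedSpace.exp ((t - s) • M)) ᵥ* M) ⬝ᵥ y s +
      (c ᵥ* NormedSpace.exp ((t - s) • M)) ⬝ᵥ (M *ᵥ z (max s 0)))) =
      ∫ s in (0 : ℝ)..t, ((c ᵥ* NormedSpace.exp ((t - s) • M)) ᵥ* M) ⬝ᵥ ν s := by
    refine intervalIntegral.integral_congr fun s hs => ?_
    rw [Set.uIcc_of_le ht] at hs
    simp only [max_eq_left hs.1, hyz s hs.1, Matrix.dotProduct_mulVec, dotProduct_add,
      neg_dotProduct]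
    ring
  rw [hcongr] at hint
  have hy0 : y 0 = z 0 := by simp [hy]
  rw [hint, hyz t ht, dotProduct_add]
  simp [hy0]
  ring

end Deterministic

/-! ### Exchanging expectation and time integral. -/

section Fubini

theorem MeasureTheory.MemLp.integrable_fun_mul {Ω : Type*} [MeasurableSpace Ω] {P : Measure Ω}
    {f g : Ω → ℝ} (hf : MemLp f 2 P) (hg : MemLp g 2 P) : Integrable (fun ω => f ω * g ω) P :=
  hf.integrable_mul hg

variable {Ω : Type*} [MeasurableSpace Ω] {P : Measure Ω} [IsProbabilityMeasure P]

/-- Cauchy–Schwarz, read off from the nonnegativity of the integral of `(t f - I) ^ 2`, where `I` is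
the integral of `f`. -/
theorem sq_intervalIntegral_le {f : ℝ → ℝ} (hf : Continuous f) {t : ℝ} (ht : 0 ≤ t) :
    (∫ s in (0 : ℝ)..t, f s) ^ 2 ≤ t * ∫ s in (0 : ℝ)..t, f s ^ 2 := by
  rcases ht.eq_or_lt with rfl | ht0
  · simp
  set I := ∫ s in (0 : ℝ)..t, f s
  have h : 0 ≤ ∫ s in (0 : ℝ)..t, (t * f s - I) ^ 2 :=
    intervalIntegral.integral_nonneg ht fun s _ => sq_nonneg _
  have h2 : ∫ s in (0 : ℝ)..t, (t * f s - I) ^ 2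
      = t ^ 2 * (∫ s in (0 : ℝ)..t, f s ^ 2) - 2 * t * I * I + t * I ^ 2 := by
    have e : ∀ s, (t * f s - I) ^ 2 = t ^ 2 * f s ^ 2 - 2 * t * I * f s + I ^ 2 := fun s => by ring
    simp only [e]
    rw [intervalIntegral.integral_add, intervalIntegral.integral_sub,
      intervalIntegral.integral_const_mul, intervalIntegral.integral_const_mul,
      intervalIntegral.integral_const]
    · simp [I]
    all_goals exact Continuous.intervalIntegrable (by fun_prop) _ _
  rw [h2] at h
  have h3 : 0 ≤ t * (t * (∫ s in (0 : ℝ)..t, f s ^ 2) - I ^ 2) := by linarith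
  linarith [nonneg_of_mul_nonneg_right h3 ht0]

theorem integrable_prod_sq {f : ℝ → Ω → ℝ} (hm : Measurable (Function.uncurry f))
    (hL : ∀ s, 0 ≤ s → MemLp (f s) 2 P) {t b : ℝ}
    (hb : ∀ s, 0 ≤ s → s ≤ t → ∫ ω, f s ω ^ 2 ∂P ≤ b) :
    Integrable (fun q : ℝ × Ω => f q.1 q.2 ^ 2) ((volume.restrict (Set.Ioc 0 t)).prod P) := by
  have hms : AEStronglyMeasurable (fun q : ℝ × Ω => f q.1 q.2 ^ 2)
    ((volume.restrict (Set.Ioc 0 t)).prod P) := (hm.pow_const 2).aestronglyMeasurable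
  rw [integrable_prod_iff hms]
  refine ⟨?_, ?_⟩
  · filter_upwards [ae_restrict_mem measurableSet_Ioc] with s hs using (hL s hs.1.le).integrable_sq
  refine Integrable.of_bound (C := b) hms.norm.integral_prod_right' ?_
  filter_upwards [ae_restrict_mem measurableSet_Ioc] with s hs
  simp only [norm_pow, Real.norm_eq_abs, sq_abs]
  rw [abs_of_nonneg (integral_nonneg fun ω => sq_nonneg _)]
  exact hb s hs.1.le hs.2

theorem memLp_intervalIntegral {f : ℝ → Ω → ℝ} (hm : Measurable (Function.uncurry f))
    (hc : ∀ ω, Continuous fun s => f s ω) (hL : ∀ s, MemLp (f s) 2 P) {t b : ℝ} (ht : 0 ≤ t)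
    (hb : ∀ s, 0 ≤ s → s ≤ t → ∫ ω, f s ω ^ 2 ∂P ≤ b) :
    MemLp (fun ω => ∫ s in (0 : ℝ)..t, f s ω) 2 P := by
  have hms : StronglyMeasurable fun ω => ∫ s in (0 : ℝ)..t, f s ω := by
    simp only [intervalIntegral.integral_of_le ht]
    exact StronglyMeasurable.integral_prod_left (μ := volume.restrict (Set.Ioc 0 t))
      hm.stronglyMeasurable
  rw [memLp_two_iff_integrable_sq hms.aestronglyMeasurable]
  refine (((integrable_prod_sq hm (fun s _ => hL s) hb).integral_prod_right).const_mul t).mono'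
    (hms.pow 2).aestronglyMeasurable (ae_of_all _ fun ω => ?_)
  rw [Real.norm_eq_abs, abs_of_nonneg (sq_nonneg _), ← intervalIntegral.integral_of_le ht]
  exact sq_intervalIntegral_le (hc ω) ht

/-- Fubini applies because `|U f| ≤ U ^ 2 + f ^ 2`, and both squares are integrable on the product.
-/
theorem integral_mul_intervalIntegral {f : ℝ → Ω → ℝ} (hm : Measurable (Function.uncurry f))
    (hL : ∀ s, MemLp (f s) 2 P) {t b : ℝ} (ht : 0 ≤ t)
    (hb : ∀ s, 0 ≤ s → s ≤ t → ∫ ω, f s ω ^ 2 ∂P ≤ b) {U : Ω → ℝ} (hU : MemLp U 2 P) :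
    ∫ ω, U ω * (∫ s in (0 : ℝ)..t, f s ω) ∂P = ∫ s in (0 : ℝ)..t, ∫ ω, U ω * f s ω ∂P := by
  have hi : Integrable (fun q : ℝ × Ω => U q.2 * f q.1 q.2)
      ((volume.restrict (Set.Ioc 0 t)).prod P) := by
    have h1 := integrable_prod_sq hm (fun s _ => hL s) hb
    have h2 : Integrable (fun q : ℝ × Ω => U q.2 ^ 2) ((volume.restrict (Set.Ioc 0 t)).prod P) :=
      hU.integrable_sq.comp_snd _
    refine (h1.add h2).mono' (hU.aestronglyMeasurable.comp_snd.mul hm.aestronglyMeasurable)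
      (ae_of_all _ fun q => ?_)
    simp only [Pi.add_apply, norm_mul, Real.norm_eq_abs]
    nlinarith [sq_nonneg (|U q.2| - |f q.1 q.2|), sq_abs (U q.2), sq_abs (f q.1 q.2),
      sq_nonneg (U q.2), sq_nonneg (f q.1 q.2)]
  simp only [intervalIntegral.integral_of_le ht, ← integral_const_mul]
  exact integral_integral_swap (f := fun ω s => U ω * f s ω) hi.swap

end Fubini

/-! ### Integration by parts against the Wiener covariance kernel. -/

section Calculus

/-- Integration by parts: `min s r` has derivative `1` in `r` before `s` and `0` after. As `min s r`
is the covariance kernel of the noise, this plays the role of the Itô isometry. -/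
theorem intervalIntegral_min_mul_eq {a b : ℝ → ℝ} (ha : ∀ r, HasDerivAt a (-b r) r)
    (hb : Continuous b) {s t : ℝ} (hs : 0 ≤ s) (hst : s ≤ t) :
    s * a t + ∫ r in (0 : ℝ)..t, min s r * b r = ∫ r in (0 : ℝ)..s, a r := by
  have hac : Continuous a := continuous_iff_continuousAt.2 fun r => (ha r).continuousAt
  have hmc : Continuous fun r => min s r * b r := by fun_prop
  rw [← intervalIntegral.integral_add_adjacent_intervals (b := s)
    (hmc.intervalIntegrable _ _) (hmc.intervalIntegrable _ _)]
  have e1 : ∫ r in (0 : ℝ)..s, min s r * b r = (∫ r in (0 : ℝ)..s, a r) - s * a s := by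
    have h1 : ∫ r in (0 : ℝ)..s, min s r * b r = ∫ r in (0 : ℝ)..s, r * b r := by
      refine intervalIntegral.integral_congr fun r hr => ?_
      rw [Set.uIcc_of_le hs] at hr
      simp only [min_eq_right hr.2]
    have h2 := intervalIntegral.integral_eq_sub_of_hasDerivAt (a := 0) (b := s)
      (fun r _ => ((hasDerivAt_id r).mul (ha r)))
      (Continuous.intervalIntegrable (by fun_prop) _ _)
    simp only [id, one_mul, mul_neg, Pi.mul_apply, zero_mul, sub_zero, ← sub_eq_add_neg] at h2
    rw [intervalIntegral.integral_sub (hac.intervalIntegrable _ _)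
      (Continuous.intervalIntegrable (by fun_prop) _ _)] at h2
    rw [h1]
    linarith
  have e2 : ∫ r in s..t, min s r * b r = s * (a s - a t) := by
    have h1 : ∫ r in s..t, min s r * b r = ∫ r in s..t, s * b r := by
      refine intervalIntegral.integral_congr fun r hr => ?_
      rw [Set.uIcc_of_le hst] at hr
      simp only [min_eq_left hr.1]
    have h2 := intervalIntegral.integral_eq_sub_of_hasDerivAt (a := s) (b := t)
      (fun r _ => ha r) (hb.neg.intervalIntegrable _ _)
    rw [intervalIntegral.integral_neg] at h2
    rw [h1, intervalIntegral.integral_const_mul, show (∫ r in s..t, b r) = a s - a t by linarith]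
  rw [e1, e2]
  ring

end Calculus

/-! ### Second moments of the noise response. -/

section Response

variable {Ω : Type*} [MeasurableSpace Ω] {P : Measure Ω} {ι : Type*} [Fintype ι]

theorem IsNoise.memLp_dotProduct {N : ℝ → Ω → ι → ℝ} {Sig : Matrix ι ι ℝ} (h : IsNoise N Sig P)
    (g : ι → ℝ) (t : ℝ) : MemLp (fun ω => g ⬝ᵥ N t ω) 2 P :=
  memLp_finsetSum _ fun i _ => (h.memLp t i).const_mul _

theorem IsNoise.measurable_uncurry_dotProduct {N : ℝ → Ω → ι → ℝ} {Sig : Matrix ι ι ℝ}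
    (h : IsNoise N Sig P) {g : ℝ → ι → ℝ} (hg : Continuous g) :
    Measurable (Function.uncurry fun s ω => g s ⬝ᵥ N s ω) := by
  refine Finset.measurable_sum _ fun i _ => Measurable.mul ?_ (h.measurable_uncurry i)
  exact (((continuous_apply i).comp hg).measurable).comp measurable_fst

theorem IsNoise.continuous_dotProduct {N : ℝ → Ω → ι → ℝ} {Sig : Matrix ι ι ℝ}
    (h : IsNoise N Sig P) {g : ℝ → ι → ℝ} (hg : Continuous g) (ω : Ω) :
    Continuous fun s => g s ⬝ᵥ N s ω :=
  hg.dotProduct (continuous_pi fun i => h.continuous ω i)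

theorem IsNoise.integral_mul_dotProduct {N : ℝ → Ω → ι → ℝ} {Sig : Matrix ι ι ℝ}
    (h : IsNoise N Sig P) (g : ι → ℝ) (t : ℝ) {U : Ω → ℝ} (hU : MemLp U 2 P) :
    ∫ ω, U ω * (g ⬝ᵥ N t ω) ∂P = g ⬝ᵥ fun i => ∫ ω, U ω * N t ω i ∂P := by
  simp only [dotProduct, Finset.mul_sum, mul_left_comm _ (g _)]
  rw [integral_finsetSum _ fun i _ => (hU.integrable_fun_mul (h.memLp t i)).const_mul _]
  simp only [integral_const_mul]

theorem IsNoise.integral_eval_mul_dotProduct {N : ℝ → Ω → ι → ℝ} {Sig : Matrix ι ι ℝ}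
    (h : IsNoise N Sig P) (hSig : Sigᵀ = Sig) (g : ι → ℝ) {s t : ℝ} (hs : 0 ≤ s) (ht : 0 ≤ t)
    (i : ι) : ∫ ω, N s ω i * (g ⬝ᵥ N t ω) ∂P = min s t * (g ᵥ* Sig) i := by
  rw [h.integral_mul_dotProduct g t (h.memLp s i)]
  simp only [h.cov s t hs ht, dotProduct, Matrix.vecMul, Finset.mul_sum]
  refine Finset.sum_congr rfl fun j _ => ?_
  rw [← congrFun (congrFun hSig i) j, Matrix.transpose_apply]
  ring

/-- The second moment is a continuous function of `s`, hence bounded on the compact interval; this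
provides the bound that the Fubini lemmas require. -/
theorem IsNoise.integral_dotProduct_sq_le {N : ℝ → Ω → ι → ℝ} {Sig : Matrix ι ι ℝ}
    (h : IsNoise N Sig P) (hSig : Sigᵀ = Sig) {g : ℝ → ι → ℝ} (hg : Continuous g)
    (t : ℝ) : ∃ b : ℝ, ∀ s, 0 ≤ s → s ≤ t → ∫ ω, (g s ⬝ᵥ N s ω) ^ 2 ∂P ≤ b := by
  have hc : Continuous fun s => g s ⬝ᵥ fun i => s * (g s ᵥ* Sig) i := by
    refine hg.dotProduct (continuous_pi fun i => continuous_id.mul ?_)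
    exact (continuous_apply i).comp (hg.matrix_vecMul continuous_const)
  obtain ⟨b, hb⟩ := (isCompact_Icc (a := (0 : ℝ)) (b := t)).bddAbove_image hc.continuousOn
  refine ⟨b, fun s hs hst => ?_⟩
  refine le_of_eq_of_le ?_ (hb ⟨s, ⟨hs, hst⟩, rfl⟩)
  simp only [sq]
  rw [h.integral_mul_dotProduct (g s) s (h.memLp_dotProduct (g s) s)]
  congr 1
  ext i
  simp only [mul_comm _ (N s _ i)]
  rw [h.integral_eval_mul_dotProduct hSig (g s) hs hs, min_self]

variable [DecidableEq ι]

/-- The component along `c` of the response at time `t` of `ż = M z + Ṅ`, `z(0) = 0`. -/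
noncomputable def Matrix.noiseResponse (M : Matrix ι ι ℝ) (N : ℝ → Ω → ι → ℝ) (c : ι → ℝ) (t : ℝ) (ω : Ω) : ℝ :=
  c ⬝ᵥ N t ω + ∫ s in (0 : ℝ)..t, ((c ᵥ* NormedSpace.exp ((t - s) • M)) ᵥ* M) ⬝ᵥ N s ω

theorem Matrix.continuous_vecMul_exp_sub (M : Matrix ι ι ℝ) (c : ι → ℝ) (t : ℝ) :
    Continuous (fun s : ℝ => c ᵥ* NormedSpace.exp ((t - s) • M)) :=
  (M.continuous_vecMul_exp c).comp (continuous_const.sub continuous_id)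

variable [IsProbabilityMeasure P]

theorem IsNoise.memLp_noiseResponse {N : ℝ → Ω → ι → ℝ} {Sig : Matrix ι ι ℝ}
    (h : IsNoise N Sig P) (hSig : Sigᵀ = Sig) (M : Matrix ι ι ℝ) (c : ι → ℝ) {t : ℝ} (ht : 0 ≤ t) :
    MemLp (M.noiseResponse N c t) 2 P := by
  have hg : Continuous fun s : ℝ => (c ᵥ* NormedSpace.exp ((t - s) • M)) ᵥ* M :=
    (M.continuous_vecMul_exp_sub c t).matrix_vecMul continuous_const
  obtain ⟨b, hb⟩ := h.integral_dotProduct_sq_le hSig hg t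
  exact (h.memLp_dotProduct c t).add (memLp_intervalIntegral (h.measurable_uncurry_dotProduct hg)
    (h.continuous_dotProduct hg) (fun s => h.memLp_dotProduct _ s) ht hb)

/-- Formally the response is the integral of `c exp ((t - r) M)` against `dN r`, and `N s`
correlates only with the part `r ≤ s`. -/
theorem IsNoise.integral_noiseResponse_mul {N : ℝ → Ω → ι → ℝ} {Sig : Matrix ι ι ℝ}
    (h : IsNoise N Sig P) (hSig : Sigᵀ = Sig) (M : Matrix ι ι ℝ) (c : ι → ℝ) {s t : ℝ}
    (hs : 0 ≤ s) (hst : s ≤ t) (i : ι) :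
    ∫ ω, M.noiseResponse N c t ω * N s ω i ∂P =
      ∫ r in (0 : ℝ)..s, ((c ᵥ* NormedSpace.exp ((t - r) • M)) ᵥ* Sig) i := by
  have ht : 0 ≤ t := hs.trans hst
  have hg : Continuous fun s : ℝ => (c ᵥ* NormedSpace.exp ((t - s) • M)) ᵥ* M :=
    (M.continuous_vecMul_exp_sub c t).matrix_vecMul continuous_const
  obtain ⟨b, hb⟩ := h.integral_dotProduct_sq_le hSig hg t
  have hI := memLp_intervalIntegral (h.measurable_uncurry_dotProduct hg)
    (h.continuous_dotProduct hg) (fun s => h.memLp_dotProduct _ s) ht hb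
  have hder : ∀ r, HasDerivAt (fun r : ℝ => ((c ᵥ* NormedSpace.exp ((t - r) • M)) ᵥ* Sig) i)
      (-((((c ᵥ* NormedSpace.exp ((t - r) • M)) ᵥ* M) ᵥ* Sig) i)) r := by
    intro r
    have h1 := (M.hasDerivAt_vecMul_exp_sub c t r).mulVec' Sigᵀ
    simpa only [Matrix.mulVec_transpose, Matrix.neg_vecMul, Pi.neg_apply] using hasDerivAt_pi.1 h1 i
  have hmin := intervalIntegral_min_mul_eq hder
    ((continuous_apply i).comp (hg.matrix_vecMul continuous_const)) hs hst
  rw [← hmin]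
  simp only [Matrix.noiseResponse, mul_comm _ (N s _ i), mul_add]
  rw [integral_add ((h.memLp s i).integrable_fun_mul (h.memLp_dotProduct c t))
    ((h.memLp s i).integrable_fun_mul hI),
    integral_mul_intervalIntegral (h.measurable_uncurry_dotProduct hg)
      (fun s => h.memLp_dotProduct _ s) ht hb (h.memLp s i),
    h.integral_eval_mul_dotProduct hSig c hs ht, min_eq_left hst]
  congr 1
  · simp
  · refine intervalIntegral.integral_congr fun r hr => ?_
    rw [Set.uIcc_of_le ht] at hr
    exact h.integral_eval_mul_dotProduct hSig _ hs hr.1 i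

/-- Expanding one factor of the square expresses it through the correlations of the response with `N
s`. Integration by parts gives the usual integral of the `Sig`-form along the semigroup, which the
Lyapunov equation evaluates in closed form. -/
theorem IsNoise.integral_noiseResponse_sq {N : ℝ → Ω → ι → ℝ} {Sig X M : Matrix ι ι ℝ}
    (h : IsNoise N Sig P) (hSig : Sigᵀ = Sig) (hX : M * X + X * Mᵀ + Sig = 0) (c : ι → ℝ) {t : ℝ}
    (ht : 0 ≤ t) :
    ∫ ω, M.noiseResponse N c t ω ^ 2 ∂P = c ⬝ᵥ (X *ᵥ c) -
      (c ᵥ* NormedSpace.exp (t • M)) ⬝ᵥ (X *ᵥ (c ᵥ* NormedSpace.exp (t • M))) := by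
  have hGc := M.continuous_vecMul_exp_sub c t
  have hg : Continuous fun s : ℝ => (c ᵥ* NormedSpace.exp ((t - s) • M)) ᵥ* M :=
    hGc.matrix_vecMul continuous_const
  obtain ⟨b, hb⟩ := h.integral_dotProduct_sq_le hSig hg t
  have hI := memLp_intervalIntegral (h.measurable_uncurry_dotProduct hg)
    (h.continuous_dotProduct hg) (fun s => h.memLp_dotProduct _ s) ht hb
  have hR := h.memLp_noiseResponse hSig M c ht
  have hGS : Continuous fun r : ℝ => (c ᵥ* NormedSpace.exp ((t - r) • M)) ᵥ* Sig :=
    hGc.matrix_vecMul continuous_const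
  -- For `0 ≤ s ≤ t`, the correlation of the response at time `t` with the noise at time `s`.
  set H : ℝ → ι → ℝ := fun s i =>
    ∫ r in (0 : ℝ)..s, ((c ᵥ* NormedSpace.exp ((t - r) • M)) ᵥ* Sig) i with hH
  have hHd : ∀ s, HasDerivAt H ((c ᵥ* NormedSpace.exp ((t - s) • M)) ᵥ* Sig) s := fun s =>
    hasDerivAt_pi.2 fun i =>
      (((continuous_apply i).comp hGS).integral_hasStrictDerivAt 0 s).hasDerivAt
  have hHc : Continuous H := continuous_iff_continuousAt.2 fun s => (hHd s).continuousAt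
  have e1 : ∫ ω, M.noiseResponse N c t ω ^ 2 ∂P = c ⬝ᵥ H t +
      ∫ s in (0 : ℝ)..t, ((c ᵥ* NormedSpace.exp ((t - s) • M)) ᵥ* M) ⬝ᵥ H s := by
    have e0 : ∀ ω, M.noiseResponse N c t ω ^ 2 = M.noiseResponse N c t ω * (c ⬝ᵥ N t ω) +
        M.noiseResponse N c t ω *
          ∫ s in (0 : ℝ)..t, ((c ᵥ* NormedSpace.exp ((t - s) • M)) ᵥ* M) ⬝ᵥ N s ω := by
      intro ω
      rw [sq, ← mul_add]
      rfl
    simp only [e0]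
    rw [integral_add (hR.integrable_fun_mul (h.memLp_dotProduct c t)) (hR.integrable_fun_mul hI),
      integral_mul_intervalIntegral (h.measurable_uncurry_dotProduct hg)
        (fun s => h.memLp_dotProduct _ s) ht hb hR, h.integral_mul_dotProduct c t hR]
    congr 1
    · simp only [h.integral_noiseResponse_mul hSig M c ht le_rfl, hH]
    · refine intervalIntegral.integral_congr fun s hs => ?_
      rw [Set.uIcc_of_le ht] at hs
      rw [h.integral_mul_dotProduct _ s hR]
      simp only [h.integral_noiseResponse_mul hSig M c hs.1 hs.2, hH]
  have hGSG : Continuous fun s : ℝ => (c ᵥ* NormedSpace.exp ((t - s) • M)) ⬝ᵥ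
      ((c ᵥ* NormedSpace.exp ((t - s) • M)) ᵥ* Sig) := hGc.dotProduct hGS
  have e2 := intervalIntegral.integral_eq_sub_of_hasDerivAt (a := 0) (b := t)
    (fun s _ => (M.hasDerivAt_vecMul_exp_sub c t s).dotProduct' (hHd s))
    (((hg.neg.dotProduct hHc).add hGSG).intervalIntegrable _ _)
  have hgH : Continuous fun s : ℝ => -((c ᵥ* NormedSpace.exp ((t - s) • M)) ᵥ* M) ⬝ᵥ H s :=
    hg.neg.dotProduct hHc
  rw [intervalIntegral.integral_add (hgH.intervalIntegrable _ _)
    (hGSG.intervalIntegrable _ _)] at e2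
  simp only [neg_dotProduct, intervalIntegral.integral_neg] at e2
  have hH0 : H 0 = 0 := by ext i; simp [hH]
  have hSv : ∀ u, u ᵥ* Sig = Sig *ᵥ u := fun u => by rw [← Matrix.mulVec_transpose, hSig]
  -- By the Lyapunov equation the integrand is the exact derivative of the form of `X` in `s`.
  have e3 := intervalIntegral.integral_eq_sub_of_hasDerivAt (a := 0) (b := t)
    (f := fun s : ℝ => (c ᵥ* NormedSpace.exp ((t - s) • M)) ⬝ᵥ
      (X *ᵥ (c ᵥ* NormedSpace.exp ((t - s) • M))))
    (f' := fun s : ℝ => (c ᵥ* NormedSpace.exp ((t - s) • M)) ⬝ᵥ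
      ((c ᵥ* NormedSpace.exp ((t - s) • M)) ᵥ* Sig)) (fun s _ => by
        have h1 := (M.hasDerivAt_exp_bilin X c c (t - s)).scomp s ((hasDerivAt_id s).const_sub t)
        rw [eq_neg_of_add_eq_zero_left hX] at h1
        simp only [Function.comp_def, neg_smul, one_smul, Matrix.neg_mulVec, dotProduct_neg,
          neg_neg] at h1
        rwa [hSv]) (hGSG.intervalIntegrable _ _)
  rw [e3] at e2
  simp only [sub_self, zero_smul, NormedSpace.exp_zero, Matrix.vecMul_one, sub_zero, hH0,
    dotProduct_zero] at e2
  rw [e1]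
  linarith

end Response

/-! ### Time averages of convergent functions. -/

section Average

/-- Rescaling `t = T u` makes the average an integral over `u` in `(0, 1]`, where dominated
convergence applies. -/
theorem tendsto_average_of_tendsto {e : ℝ → ℝ} {b C : ℝ} (hm : Measurable e)
    (hC : ∀ t, 0 ≤ t → |e t| ≤ C) (he : Tendsto e atTop (𝓝 b)) :
    Tendsto (fun T => T⁻¹ * ∫ t in (0 : ℝ)..T, e t) atTop (𝓝 b) := by
  have h1 : Tendsto (fun T : ℝ => ∫ u in Set.Ioc (0 : ℝ) 1, e (T * u)) atTop
      (𝓝 (∫ _ in Set.Ioc (0 : ℝ) 1, b)) := by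
    refine tendsto_integral_filter_of_dominated_convergence (fun _ => C)
      (Eventually.of_forall fun T => (hm.comp (measurable_const_mul T)).aestronglyMeasurable) ?_
      (integrable_const _) ?_
    · filter_upwards [eventually_ge_atTop 0] with T hT
      filter_upwards [ae_restrict_mem measurableSet_Ioc] with u hu
      exact hC _ (mul_nonneg hT hu.1.le)
    · filter_upwards [ae_restrict_mem measurableSet_Ioc] with u hu
      exact he.comp (tendsto_id.atTop_mul_const hu.1)
  simp only [integral_const, MeasurableSet.univ, measureReal_restrict_apply, Set.univ_inter,
    Real.volume_real_Ioc, sub_zero, zero_le_one, sup_of_le_left, one_smul] at h1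
  refine h1.congr' ?_
  filter_upwards [eventually_gt_atTop 0] with T hT
  rw [← intervalIntegral.integral_of_le zero_le_one,
    intervalIntegral.integral_comp_mul_left _ hT.ne']
  simp

theorem exists_abs_le_of_continuous_of_tendsto {f : ℝ → ℝ} {b : ℝ} (hf : Continuous f)
    (h : Tendsto f atTop (𝓝 b)) : ∃ C, ∀ t, 0 ≤ t → |f t| ≤ C := by
  obtain ⟨T, hT⟩ := eventually_atTop.1 (h.abs.eventually_le_const (lt_add_one |b|))
  obtain ⟨C, hC⟩ := (isCompact_Icc (a := (0 : ℝ)) (b := T)).bddAbove_image hf.abs.continuousOn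
  refine ⟨max C (|b| + 1), fun t ht => ?_⟩
  rcases le_total t T with h1 | h1
  · exact le_max_of_le_left (hC ⟨t, ⟨ht, h1⟩, rfl⟩)
  · exact le_max_of_le_right (hT t h1)

end Average

/-! ### The response with a random initial state. -/

section Response

variable {Ω : Type*} [MeasurableSpace Ω] {P : Measure Ω} {ι : Type*} [Fintype ι] [DecidableEq ι]

theorem IsNoise.continuous_noiseResponse {N : ℝ → Ω → ι → ℝ} {Sig : Matrix ι ι ℝ}
    (h : IsNoise N Sig P) (M : Matrix ι ι ℝ) (c : ι → ℝ) (ω : Ω) :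
    Continuous fun t => M.noiseResponse N c t ω := by
  refine (h.continuous_dotProduct continuous_const ω).add
    (intervalIntegral.continuous_parametric_intervalIntegral_of_continuous ?_ continuous_id)
  have h1 : Continuous fun q : ℝ × ℝ => (c ᵥ* NormedSpace.exp ((q.1 - q.2) • M)) ᵥ* M :=
    ((M.continuous_vecMul_exp c).comp (continuous_fst.sub continuous_snd)).matrix_vecMul
      continuous_const
  exact h1.dotProduct (continuous_pi fun i => (h.continuous ω i).comp continuous_snd)

theorem IsNoise.measurable_noiseResponse {N : ℝ → Ω → ι → ℝ} {Sig : Matrix ι ι ℝ}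
    (h : IsNoise N Sig P) (M : Matrix ι ι ℝ) (c : ι → ℝ) :
    Measurable (Function.uncurry (M.noiseResponse N c)) := by
  refine measurable_uncurry_of_continuous_of_measurable (h.continuous_noiseResponse M c) fun t => ?_
  have hg : Continuous fun s : ℝ => (c ᵥ* NormedSpace.exp ((t - s) • M)) ᵥ* M :=
    (M.continuous_vecMul_exp_sub c t).matrix_vecMul continuous_const
  have hm := (h.measurable_uncurry_dotProduct hg).stronglyMeasurable
  have hsec : Measurable fun ω => c ⬝ᵥ N t ω :=
    Finset.measurable_sum _ fun i _ => (h.measurable t i).const_mul _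
  refine hsec.add ?_
  simp only [intervalIntegral]
  exact (StronglyMeasurable.integral_prod_left (μ := volume.restrict _) hm).measurable.sub
    (StronglyMeasurable.integral_prod_left (μ := volume.restrict _) hm).measurable

/-- The component along `c` of the response at time `t` of `ż = M z + Ṅ`, `z(0) = z₀`. -/
noncomputable def Matrix.stateResponse (M : Matrix ι ι ℝ) (N : ℝ → Ω → ι → ℝ) (z₀ : Ω → ι → ℝ)
    (c : ι → ℝ) (t : ℝ) (ω : Ω) : ℝ :=
  (c ᵥ* NormedSpace.exp (t • M)) ⬝ᵥ z₀ ω + M.noiseResponse N c t ω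

variable {N : ℝ → Ω → ι → ℝ} {Sig X M : Matrix ι ι ℝ} {z₀ : Ω → ι → ℝ}

theorem IsNoise.continuous_stateResponse (h : IsNoise N Sig P) (c : ι → ℝ) (ω : Ω) :
    Continuous fun t => M.stateResponse N z₀ c t ω :=
  ((M.continuous_vecMul_exp c).dotProduct continuous_const).add (h.continuous_noiseResponse M c ω)

theorem IsNoise.measurable_stateResponse (h : IsNoise N Sig P) (hz : Measurable z₀) (c : ι → ℝ) :
    Measurable (Function.uncurry (M.stateResponse N z₀ c)) := by
  refine Measurable.add ?_ (h.measurable_noiseResponse M c)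
  refine Finset.measurable_sum _ fun i _ => Measurable.mul ?_ ?_
  · exact (((continuous_apply i).comp (M.continuous_vecMul_exp c)).measurable).comp measurable_fst
  · exact ((measurable_pi_apply i).comp hz).comp measurable_snd

variable [IsProbabilityMeasure P]

theorem IsNoise.memLp_stateResponse (h : IsNoise N Sig P) (hSig : Sigᵀ = Sig)
    (hz : ∀ i, MemLp (fun ω => z₀ ω i) 2 P) (c : ι → ℝ) {t : ℝ} (ht : 0 ≤ t) :
    MemLp (M.stateResponse N z₀ c t) 2 P :=
  (memLp_finsetSum _ fun i _ => (hz i).const_mul _).add (h.memLp_noiseResponse hSig M c ht)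

/-- The initial state may be correlated with the noise. The cross term still vanishes in the limit:
it pairs the decaying vector `k t` with the moments `v t`, which are bounded for `t ≥ 0`. -/
theorem IsNoise.stateResponse_secondMoment (h : IsNoise N Sig P) (hSig : Sigᵀ = Sig)
    (hM : IsStableMatrix M) (hX : M * X + X * Mᵀ + Sig = 0)
    (hz : ∀ i, MemLp (fun ω => z₀ ω i) 2 P) (c : ι → ℝ) :
    Tendsto (fun t => ∫ ω, M.stateResponse N z₀ c t ω ^ 2 ∂P) atTop (𝓝 (c ⬝ᵥ (X *ᵥ c))) ∧
      ∃ C, ∀ t, 0 ≤ t → ∫ ω, M.stateResponse N z₀ c t ω ^ 2 ∂P ≤ C := by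
  set k : ℝ → ι → ℝ := fun t => c ᵥ* NormedSpace.exp (t • M) with hk
  have hkc : Continuous k := M.continuous_vecMul_exp c
  have hk0 : Tendsto k atTop (𝓝 0) := hM.tendsto_vecMul_exp c
  set Z : Matrix ι ι ℝ := Matrix.of fun i j => ∫ ω, z₀ ω i * z₀ ω j ∂P with hZ
  set v : ℝ → ι → ℝ := fun t i => ∫ ω, M.noiseResponse N c t ω * z₀ ω i ∂P with hv
  set a : ℝ → ℝ := fun t => k t ⬝ᵥ (Z *ᵥ k t) with ha
  set f : ℝ → ℝ := fun t => c ⬝ᵥ (X *ᵥ c) - k t ⬝ᵥ (X *ᵥ k t) with hf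
  have hlin : ∀ (g : ι → ℝ) {U : Ω → ℝ}, MemLp U 2 P →
      ∫ ω, U ω * (g ⬝ᵥ z₀ ω) ∂P = g ⬝ᵥ fun i => ∫ ω, U ω * z₀ ω i ∂P := by
    intro g U hU
    simp only [dotProduct, Finset.mul_sum, mul_left_comm _ (g _)]
    rw [integral_finsetSum _ fun i _ => (hU.integrable_fun_mul (hz i)).const_mul _]
    simp only [integral_const_mul]
  have hzd : ∀ g : ι → ℝ, MemLp (fun ω => g ⬝ᵥ z₀ ω) 2 P := fun g =>
    memLp_finsetSum _ fun i _ => (hz i).const_mul _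
  have hea : ∀ t, ∫ ω, (k t ⬝ᵥ z₀ ω) ^ 2 ∂P = a t := by
    intro t
    simp only [sq]
    rw [hlin _ (hzd _), ha]
    simp only
    congr 1
    ext i
    simp only [mul_comm _ (z₀ _ i)]
    rw [hlin _ (hz i), dotProduct_comm]
    rfl
  have hef : ∀ t, 0 ≤ t → ∫ ω, M.noiseResponse N c t ω ^ 2 ∂P = f t := fun t ht =>
    h.integral_noiseResponse_sq hSig hX c ht
  have htot : ∀ t, 0 ≤ t → ∫ ω, M.stateResponse N z₀ c t ω ^ 2 ∂P = a t + 2 * (k t ⬝ᵥ v t) + f t := by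
    intro t ht
    have hR := h.memLp_noiseResponse hSig M c ht
    have hi : Integrable (fun ω => (k t ⬝ᵥ z₀ ω) ^ 2 +
        2 * (M.noiseResponse N c t ω * (k t ⬝ᵥ z₀ ω))) P :=
      (hzd _).integrable_sq.add ((hR.integrable_fun_mul (hzd _)).const_mul 2)
    rw [← hea, ← hef t ht, hv, ← hlin (k t) hR, ← integral_const_mul,
      ← integral_add (hzd _).integrable_sq ((hR.integrable_fun_mul (hzd _)).const_mul 2),
      ← integral_add hi hR.integrable_sq]
    congr 1
    ext ω
    simp only [Matrix.stateResponse, hk]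
    ring
  have hac : Continuous a := hkc.dotProduct (continuous_const.matrix_mulVec hkc)
  have hfc : Continuous f := continuous_const.sub (hkc.dotProduct (continuous_const.matrix_mulVec hkc))
  have ha0 : Tendsto a atTop (𝓝 0) := hM.tendsto_exp_bilin Z c c
  have hf0 : Tendsto f atTop (𝓝 (c ⬝ᵥ (X *ᵥ c))) := by
    simpa using (hM.tendsto_exp_bilin X c c).const_sub (c ⬝ᵥ (X *ᵥ c))
  obtain ⟨Cf, hCf⟩ := exists_abs_le_of_continuous_of_tendsto hfc hf0
  obtain ⟨Ca, hCa⟩ := exists_abs_le_of_continuous_of_tendsto hac ha0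
  -- From `|a b| ≤ a ^ 2 + b ^ 2`: `Z i i` is the second moment of the initial component and `Cf`
  -- bounds that of the response.
  have hvb : ∀ t, 0 ≤ t → ∀ i, |v t i| ≤ Z i i + Cf := by
    intro t ht i
    have hR := h.memLp_noiseResponse hSig M c ht
    have h1 : Z i i + Cf ≥ ∫ ω, (z₀ ω i ^ 2 + M.noiseResponse N c t ω ^ 2) ∂P := by
      rw [integral_add (hz i).integrable_sq hR.integrable_sq, hef t ht]
      have : Z i i = ∫ ω, z₀ ω i ^ 2 ∂P := by simp only [hZ, Matrix.of_apply, sq]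
      rw [this]
      linarith [le_abs_self (f t), hCf t ht]
    refine le_trans ?_ h1
    refine (abs_integral_le_integral_abs).trans ?_
    refine integral_mono (hR.integrable_fun_mul (hz i)).abs
      ((hz i).integrable_sq.add hR.integrable_sq) fun ω => ?_
    simp only [abs_mul]
    nlinarith [sq_nonneg (|z₀ ω i| - |M.noiseResponse N c t ω|), sq_abs (z₀ ω i),
      sq_abs (M.noiseResponse N c t ω), sq_nonneg (z₀ ω i), sq_nonneg (M.noiseResponse N c t ω)]
  have hcross : Tendsto (fun t => k t ⬝ᵥ v t) atTop (𝓝 0) := by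
    rw [show (0 : ℝ) = ∑ i : ι, (0 : ℝ) by simp]
    refine tendsto_finsetSum _ fun i _ => ?_
    have hki : Tendsto (fun t => |k t i| * (Z i i + Cf)) atTop (𝓝 0) := by
      simpa using ((tendsto_pi_nhds.1 hk0 i).abs).mul_const (Z i i + Cf)
    refine squeeze_zero_norm' ?_ hki
    filter_upwards [eventually_ge_atTop 0] with t ht
    rw [norm_mul]
    exact mul_le_mul_of_nonneg_left (hvb t ht i) (abs_nonneg _)
  refine ⟨?_, 2 * Ca + 2 * Cf, fun t ht => ?_⟩
  · have := (ha0.add (hcross.const_mul 2)).add hf0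
    simp only [mul_zero, zero_add] at this
    refine this.congr' ?_
    filter_upwards [eventually_ge_atTop 0] with t ht
    exact (htot t ht).symm
  · have hR := h.memLp_noiseResponse hSig M c ht
    have h1 : ∫ ω, M.stateResponse N z₀ c t ω ^ 2 ∂P ≤
        ∫ ω, (2 * (k t ⬝ᵥ z₀ ω) ^ 2 + 2 * M.noiseResponse N c t ω ^ 2) ∂P := by
      refine integral_mono (h.memLp_stateResponse hSig hz c ht).integrable_sq
        (((hzd _).integrable_sq.const_mul 2).add (hR.integrable_sq.const_mul 2)) fun ω => ?_
      simp only [Matrix.stateResponse, hk]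
      nlinarith [sq_nonneg ((c ᵥ* NormedSpace.exp (t • M)) ⬝ᵥ z₀ ω - M.noiseResponse N c t ω)]
    rw [integral_add ((hzd _).integrable_sq.const_mul 2) (hR.integrable_sq.const_mul 2),
      integral_const_mul, integral_const_mul, hea, hef t ht] at h1
    linarith [le_abs_self (f t), hCf t ht, le_abs_self (a t), hCa t ht]

theorem IsNoise.average_stateResponse_sq (h : IsNoise N Sig P) (hSig : Sigᵀ = Sig)
    (hM : IsStableMatrix M) (hX : M * X + X * Mᵀ + Sig = 0) (hzm : Measurable z₀)
    (hz : ∀ i, MemLp (fun ω => z₀ ω i) 2 P) (c : ι → ℝ) :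
    (∀ T, 0 ≤ T → Integrable (fun ω => ∫ t in (0 : ℝ)..T, M.stateResponse N z₀ c t ω ^ 2) P) ∧
      Tendsto (fun T => T⁻¹ * ∫ ω, (∫ t in (0 : ℝ)..T, M.stateResponse N z₀ c t ω ^ 2) ∂P) atTop
        (𝓝 (c ⬝ᵥ (X *ᵥ c))) := by
  obtain ⟨hlim, C, hC⟩ := h.stateResponse_secondMoment hSig hM hX hz c
  have hm := h.measurable_stateResponse (M := M) hzm c
  have hp : ∀ T : ℝ, Integrable (fun q : ℝ × Ω => M.stateResponse N z₀ c q.1 q.2 ^ 2)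
      ((volume.restrict (Set.Ioc 0 T)).prod P) := fun T =>
    integrable_prod_sq hm (fun s hs => h.memLp_stateResponse hSig hz c hs) fun s hs _ => hC s hs
  refine ⟨fun T hT => ?_, ?_⟩
  · simp only [intervalIntegral.integral_of_le hT]
    exact (hp T).integral_prod_right
  · have hme : Measurable fun t => ∫ ω, M.stateResponse N z₀ c t ω ^ 2 ∂P :=
      ((hm.pow_const 2).stronglyMeasurable.integral_prod_right').measurable
    refine (tendsto_average_of_tendsto (C := C) hme (fun t ht => ?_) hlim).congr' ?_
    · rw [abs_of_nonneg (integral_nonneg fun ω => sq_nonneg _)]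
      exact hC t ht
    · filter_upwards [eventually_ge_atTop 0] with T hT
      congr 1
      simp only [intervalIntegral.integral_of_le hT]
      exact integral_integral_swap (f := fun t ω => M.stateResponse N z₀ c t ω ^ 2) (hp T)

end Response

/-! ### Lyapunov and Riccati algebra: optimality of minimal stationary controllers. -/

section Algebra

variable {n m p : ℕ}

theorem IsControllable.eq_zero_of_vecMul {A : Matrix (Fin n) (Fin n) ℝ} {B : Matrix (Fin n) (Fin m) ℝ}
    (h : IsControllable A B) {v : Fin n → ℝ} (hv : ∀ k : ℕ, v ᵥ* (A ^ k * B) = 0) : v = 0 := by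
  have hr : (controllabilityMatrix A B)ᵀ.rank = n := by rw [Matrix.rank_transpose]; exact h
  have hinj : Function.Injective ((controllabilityMatrix A B)ᵀ).mulVec := by
    have h1 := LinearMap.finrank_range_add_finrank_ker ((controllabilityMatrix A B)ᵀ).mulVecLin
    rw [Matrix.rank] at hr
    rw [hr, Module.finrank_fin_fun, Nat.add_eq_left, Submodule.finrank_eq_zero] at h1
    exact LinearMap.ker_eq_bot.1 h1
  apply hinj
  rw [Matrix.mulVec_zero, Matrix.mulVec_transpose]
  ext rj
  exact congrFun (hv rj.1) rj.2

theorem IsObservable.isControllable {C : Matrix (Fin p) (Fin n) ℝ} {A : Matrix (Fin n) (Fin n) ℝ}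
    (h : IsObservable C A) : IsControllable Aᵀ Cᵀ := by
  have : controllabilityMatrix Aᵀ Cᵀ = (observabilityMatrix C A)ᵀ := by
    ext i rj
    simp [controllabilityMatrix, observabilityMatrix, ← Matrix.transpose_pow, ← Matrix.transpose_mul]
  rw [IsControllable, this, Matrix.rank_transpose]
  exact h

/-- If `X` kills `(0, v)`, testing the Lyapunov equation on `(0, v)` and using `V ≻ 0` gives `v B_K
= 0`; the equation then shows that `X` also kills `(0, v A_K)`. Iterating, `v A_K ^ k B_K = 0` for
every `k`, and controllability yields `v = 0`. -/
theorem Matrix.posDef_toBlocks₂₂_of_isControllable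
    {A AK W : Matrix (Fin n) (Fin n) ℝ} {B : Matrix (Fin n) (Fin m) ℝ}
    {CK : Matrix (Fin m) (Fin n) ℝ} {BK : Matrix (Fin n) (Fin p) ℝ} {C : Matrix (Fin p) (Fin n) ℝ}
    {V : Matrix (Fin p) (Fin p) ℝ} (hV : V.PosDef) (hK : IsControllable AK BK)
    {X : Matrix (Fin n ⊕ Fin n) (Fin n ⊕ Fin n) ℝ} (hX : X.PosSemidef)
    (h : fromBlocks A (B * CK) (BK * C) AK * X + X * (fromBlocks A (B * CK) (BK * C) AK)ᵀ
      + fromBlocks W 0 0 (BK * V * BKᵀ) = 0) : X.toBlocks₂₂.PosDef := by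
  have hstep : ∀ v : Fin n → ℝ, X *ᵥ (Sum.elim (0 : Fin n → ℝ) v) = 0 →
      v ᵥ* BK = 0 ∧ X *ᵥ (Sum.elim (0 : Fin n → ℝ) (v ᵥ* AK)) = 0 := by
    intro v hv
    have hXs : Xᵀ = X := hX.isHermitian
    have hv' : (Sum.elim (0 : Fin n → ℝ) v) ᵥ* X = 0 := by rw [← hXs, Matrix.vecMul_transpose, hv]
    have hN : fromBlocks W 0 0 (BK * V * BKᵀ) *ᵥ (Sum.elim (0 : Fin n → ℝ) v) =
        Sum.elim (0 : Fin n → ℝ) (BK *ᵥ (V *ᵥ (v ᵥ* BK))) := by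
      rw [Matrix.fromBlocks_mulVec]
      simp [← Matrix.mulVec_mulVec, Matrix.mulVec_transpose]
    have h1 := congrArg (fun N => N *ᵥ (Sum.elim (0 : Fin n → ℝ) v)) h
    simp only [Matrix.add_mulVec, ← Matrix.mulVec_mulVec, hv, Matrix.mulVec_zero, zero_add,
      Matrix.zero_mulVec, hN] at h1
    have h2 := congrArg (fun x => (Sum.elim (0 : Fin n → ℝ) v) ⬝ᵥ x) h1
    simp only [dotProduct_add, Matrix.dotProduct_mulVec _ X, hv', zero_dotProduct, zero_add,
      dotProduct_zero] at h2
    have h3 : (v ᵥ* BK) ⬝ᵥ (V *ᵥ (v ᵥ* BK)) = 0 := by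
      rw [← Matrix.dotProduct_mulVec]
      simpa [dotProduct, Fintype.sum_sum_type] using h2
    have hB : v ᵥ* BK = 0 := by
      by_contra hne
      exact (hV.dotProduct_mulVec_pos hne).ne' (by simpa using h3)
    refine ⟨hB, ?_⟩
    have hM : (fromBlocks A (B * CK) (BK * C) AK)ᵀ *ᵥ (Sum.elim (0 : Fin n → ℝ) v) = Sum.elim (0 : Fin n → ℝ) (v ᵥ* AK) := by
      rw [Matrix.mulVec_transpose, Matrix.vecMul_fromBlocks]
      simp [← Matrix.vecMul_vecMul, hB]
    rw [hM, hB] at h1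
    simpa using h1
  have h22 : X.toBlocks₂₂.PosSemidef := hX.submatrix Sum.inr
  refine Matrix.PosDef.of_dotProduct_mulVec_pos h22.isHermitian fun v hv => ?_
  refine lt_of_le_of_ne (h22.dotProduct_mulVec_nonneg v) fun h0 => hv ?_
  have hX0 : X *ᵥ (Sum.elim (0 : Fin n → ℝ) v) = 0 := by
    rw [← hX.dotProduct_mulVec_zero_iff]
    rw [h0]
    conv_lhs => rw [← Matrix.fromBlocks_toBlocks X, Matrix.fromBlocks_mulVec]
    simp [dotProduct, Fintype.sum_sum_type]
  have hall : ∀ k : ℕ, X *ᵥ (Sum.elim (0 : Fin n → ℝ) (v ᵥ* AK ^ k)) = 0 := by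
    intro k
    induction k with
    | zero => simpa using hX0
    | succ k ih =>
      rw [pow_succ, ← Matrix.vecMul_vecMul]
      exact (hstep _ ih).2
  refine hK.eq_zero_of_vecMul fun k => ?_
  rw [← Matrix.vecMul_vecMul]
  exact (hstep _ (hall k)).1

/-- From the Lyapunov equation of a closed loop whose controller state carries the estimate
`T⁻¹`-transformed with gain `T BK = P Cᵀ V⁻¹`, the filter Riccati equation for the Schur
complement `P`. -/
theorem Matrix.riccati_of_lyapunov
    {A AK W X₁₁ X₁₂ X₂₁ X₂₂ P T : Matrix (Fin n) (Fin n) ℝ} {B : Matrix (Fin n) (Fin m) ℝ}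
    {CK : Matrix (Fin m) (Fin n) ℝ} {BK : Matrix (Fin n) (Fin p) ℝ} {C : Matrix (Fin p) (Fin n) ℝ}
    {V : Matrix (Fin p) (Fin p) ℝ}
    (h : fromBlocks A (B * CK) (BK * C) AK * fromBlocks X₁₁ X₁₂ X₂₁ X₂₂
      + fromBlocks X₁₁ X₁₂ X₂₁ X₂₂ * (fromBlocks A (B * CK) (BK * C) AK)ᵀ
      + fromBlocks W 0 0 (BK * V * BKᵀ) = 0)
    (hdet : IsUnit X₂₂.det) (hV : Vᵀ = V) (hP : Pᵀ = P)
    (h12 : X₁₂ = T * X₂₂) (h21 : X₂₁ = X₂₂ * Tᵀ) (h11 : X₁₁ = P + T * X₂₂ * Tᵀ)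
    (hT : T * BK * V = P * Cᵀ) : A * P + P * Aᵀ + W = P * Cᵀ * BKᵀ * Tᵀ := by
  rw [Matrix.fromBlocks_transpose, Matrix.fromBlocks_multiply, Matrix.fromBlocks_multiply,
    Matrix.fromBlocks_add, Matrix.fromBlocks_add, ← Matrix.fromBlocks_zero,
    Matrix.fromBlocks_inj] at h
  obtain ⟨e11, e12, -, e22⟩ := h
  subst h12 h21 h11
  have hT' : V * BKᵀ * Tᵀ = C * P := by
    have := congrArg Matrix.transpose hT
    simpa [Matrix.transpose_mul, hV, hP, Matrix.mul_assoc] using this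
  -- `T` times the `(2,2)` block equation minus the `(1,2)` one, with `X₂₂` cancelled, forces the
  -- observer form of `A_K`.
  have hAK : T * AK = A * T + B * CK - T * BK * C * T := by
    have e := congrArg (fun N => T * N) e22
    simp only [Matrix.mul_add, Matrix.mul_zero] at e
    have e' : T * (BK * V * BKᵀ) = P * Cᵀ * BKᵀ := by
      rw [← hT]; simp only [Matrix.mul_assoc]
    rw [e'] at e
    have e0 : (T * AK - (A * T + B * CK - T * BK * C * T)) * X₂₂ = 0 := by
      have := congrArg₂ (· - ·) e e12
      simp only [sub_zero] at this
      rw [← this]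
      simp only [Matrix.transpose_mul, Matrix.add_mul, Matrix.sub_mul,
        Matrix.mul_assoc, add_zero]
      abel
    have := congrArg (fun N => N * X₂₂⁻¹) e0
    simp only [Matrix.mul_assoc, Matrix.mul_nonsing_inv _ hdet, Matrix.mul_one,
      Matrix.zero_mul] at this
    exact sub_eq_zero.1 (by simpa [Matrix.mul_assoc] using this)
  have hAK' : AKᵀ * Tᵀ = Tᵀ * Aᵀ + CKᵀ * Bᵀ - Tᵀ * Cᵀ * BKᵀ * Tᵀ := by
    have := congrArg Matrix.transpose hAK
    simpa [Matrix.transpose_mul, Matrix.mul_assoc] using this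
  -- Subtracting this from the `(1,1)` block equation removes every term containing `X₂₂` and leaves
  -- the equation for `P`.
  have e := congrArg (fun N => T * N * Tᵀ) e22
  simp only [Matrix.mul_add, Matrix.mul_zero, Matrix.add_mul, Matrix.zero_mul] at e
  have i1 : T * (AK * X₂₂) * Tᵀ = (A * T + B * CK - T * BK * C * T) * X₂₂ * Tᵀ := by
    rw [← hAK]; simp only [Matrix.mul_assoc]
  have i2 : T * (X₂₂ * AKᵀ) * Tᵀ = T * X₂₂ * (Tᵀ * Aᵀ + CKᵀ * Bᵀ - Tᵀ * Cᵀ * BKᵀ * Tᵀ) := by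
    rw [← hAK']; simp only [Matrix.mul_assoc]
  have i3 : T * (BK * V * BKᵀ) * Tᵀ = P * Cᵀ * BKᵀ * Tᵀ := by
    rw [← hT]; simp only [Matrix.mul_assoc]
  rw [i1, i2, i3] at e
  have := congrArg₂ (· - ·) e11 e
  simp only [sub_zero] at this
  rw [← sub_eq_zero, ← this]
  simp only [Matrix.transpose_mul, Matrix.mul_add, Matrix.add_mul, Matrix.sub_mul, Matrix.mul_sub,
        Matrix.mul_assoc]
  abel

/-- Completion of the square: pair `S` with the `(1,1)` block of the Lyapunov equation and eliminate
`Q` by the control Riccati equation. The last trace is the stationary `R`-weighted second moment of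
`u + F x`. -/
theorem Matrix.trace_cost_eq_of_riccati
    {A Q S W X₁₁ X₁₂ X₂₁ X₂₂ : Matrix (Fin n) (Fin n) ℝ} {B : Matrix (Fin n) (Fin m) ℝ}
    {F CK : Matrix (Fin m) (Fin n) ℝ} {R : Matrix (Fin m) (Fin m) ℝ}
    (h : A * X₁₁ + B * CK * X₂₁ + (X₁₁ * Aᵀ + X₁₂ * (B * CK)ᵀ) + W = 0)
    (hric : Aᵀ * S + S * A + Q = Fᵀ * R * F) (hF : R * F = Bᵀ * S) (hF' : Fᵀ * R = S * B) :
    (Q * X₁₁).trace + (CKᵀ * R * CK * X₂₂).trace = (S * W).trace +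
      (R * (F * X₁₁ * Fᵀ + F * X₁₂ * CKᵀ + CK * X₂₁ * Fᵀ + CK * X₂₂ * CKᵀ)).trace := by
  have e := congrArg (fun N => (S * N).trace) h
  simp only [Matrix.mul_add, Matrix.trace_add, Matrix.mul_zero, Matrix.trace_zero] at e
  have e2 := congrArg (fun N => (N * X₁₁).trace) hric
  simp only [Matrix.add_mul, Matrix.trace_add] at e2
  simp only [Matrix.mul_add, Matrix.trace_add]
  have t1 : (S * (B * CK * X₂₁)).trace = (R * (CK * X₂₁ * Fᵀ)).trace := by
    rw [show S * (B * CK * X₂₁) = Fᵀ * R * (CK * X₂₁) by rw [hF']; simp only [Matrix.mul_assoc],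
      Matrix.mul_assoc, Matrix.trace_mul_comm]
    simp only [Matrix.mul_assoc]
  have t2 : (S * (X₁₂ * (B * CK)ᵀ)).trace = (R * (F * X₁₂ * CKᵀ)).trace := by
    rw [show R * (F * X₁₂ * CKᵀ) = Bᵀ * S * X₁₂ * CKᵀ by rw [← hF]; simp only [Matrix.mul_assoc],
      show S * (X₁₂ * (B * CK)ᵀ) = (S * X₁₂ * CKᵀ) * Bᵀ by
        simp only [Matrix.mul_assoc, Matrix.transpose_mul], Matrix.trace_mul_comm]
    simp only [Matrix.mul_assoc]
  have t3 : (S * (X₁₁ * Aᵀ)).trace = (Aᵀ * S * X₁₁).trace := by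
    rw [← Matrix.mul_assoc, Matrix.trace_mul_comm, ← Matrix.mul_assoc]
  have t4 : (Fᵀ * R * F * X₁₁).trace = (R * (F * X₁₁ * Fᵀ)).trace := by
    rw [Matrix.mul_assoc, Matrix.mul_assoc, Matrix.trace_mul_comm]
    simp only [Matrix.mul_assoc]
  have t5 : (CKᵀ * R * CK * X₂₂).trace = (R * (CK * X₂₂ * CKᵀ)).trace := by
    rw [Matrix.mul_assoc, Matrix.mul_assoc, Matrix.trace_mul_comm]
    simp only [Matrix.mul_assoc]
  have t6 : (S * (A * X₁₁)).trace = (S * A * X₁₁).trace := by rw [Matrix.mul_assoc]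
  rw [t1, t2, t3, t6] at e
  rw [t4] at e2
  linarith

theorem Matrix.PosSemidef.exists_eq_transpose_mul_self {ι : Type*} [Fintype ι] [DecidableEq ι]
    {R : Matrix ι ι ℝ} (hR : R.PosSemidef) : ∃ G : Matrix ι ι ℝ, R = Gᵀ * G := by
  open scoped Matrix.Norms.L2Operator in
  exact CStarAlgebra.nonneg_iff_eq_star_mul_self.mp hR.nonneg

theorem Matrix.PosSemidef.trace_mul_nonneg {ι : Type*} [Fintype ι] [DecidableEq ι]
    {R Z : Matrix ι ι ℝ} (hR : R.PosSemidef) (hZ : Z.PosSemidef) : 0 ≤ (R * Z).trace := by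
  obtain ⟨G, rfl⟩ := hR.exists_eq_transpose_mul_self
  rw [Matrix.mul_assoc, Matrix.trace_mul_comm]
  exact (hZ.mul_mul_conjTranspose_same G).trace_nonneg

/-- By the filter Riccati equation, the covariance minus `diag (P, 0)` solves a Lyapunov equation
for the same closed loop with positive semidefinite forcing, so it is positive semidefinite.
Compressing it by `[F C_K]` bounds the square left over from `Matrix.trace_cost_eq_of_riccati`. -/
theorem Matrix.le_trace_cost_of_riccati
    {A AK Q S W P X₁₁ X₁₂ X₂₁ X₂₂ : Matrix (Fin n) (Fin n) ℝ} {B : Matrix (Fin n) (Fin m) ℝ}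
    {C : Matrix (Fin p) (Fin n) ℝ} {BK : Matrix (Fin n) (Fin p) ℝ}
    {F CK : Matrix (Fin m) (Fin n) ℝ} {R : Matrix (Fin m) (Fin m) ℝ} {V : Matrix (Fin p) (Fin p) ℝ}
    (hM : IsStableMatrix (fromBlocks A (B * CK) (BK * C) AK))
    (h : fromBlocks A (B * CK) (BK * C) AK * fromBlocks X₁₁ X₁₂ X₂₁ X₂₂
      + fromBlocks X₁₁ X₁₂ X₂₁ X₂₂ * (fromBlocks A (B * CK) (BK * C) AK)ᵀ
      + fromBlocks W 0 0 (BK * V * BKᵀ) = 0)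
    (hR : R.PosDef) (hV : V.PosDef) (hPs : Pᵀ = P)
    (hric : Aᵀ * S + S * A + Q = Fᵀ * R * F) (hF : R * F = Bᵀ * S) (hF' : Fᵀ * R = S * B)
    (hP : A * P + P * Aᵀ + W = P * Cᵀ * V⁻¹ * C * P) :
    (S * W).trace + (R * (F * P * Fᵀ)).trace ≤ (Q * X₁₁).trace + (CKᵀ * R * CK * X₂₂).trace := by
  have h11 : A * X₁₁ + B * CK * X₂₁ + (X₁₁ * Aᵀ + X₁₂ * (B * CK)ᵀ) + W = 0 := by
    rw [Matrix.fromBlocks_transpose, Matrix.fromBlocks_multiply, Matrix.fromBlocks_multiply,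
      Matrix.fromBlocks_add, Matrix.fromBlocks_add, ← Matrix.fromBlocks_zero,
      Matrix.fromBlocks_inj] at h
    exact h.1
  rw [Matrix.trace_cost_eq_of_riccati h11 hric hF hF', add_le_add_iff_left]
  -- Chosen so that `N V⁻¹ Nᵀ` has exactly the cross blocks `P Cᵀ B_Kᵀ` and `B_K C P` that `diag (P,
  -- 0)` produces in the Lyapunov equation.
  set N : Matrix (Fin n ⊕ Fin n) (Fin p) ℝ := Matrix.fromRows (P * Cᵀ) (BK * V) with hN
  have hVdet : IsUnit V.det := (Matrix.isUnit_iff_isUnit_det _).1 hV.isUnit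
  have hVs : Vᵀ = V := hV.isHermitian
  have hNpos : (N * V⁻¹ * Nᵀ).PosSemidef := hV.inv.posSemidef.mul_mul_conjTranspose_same N
  have hNeq : N * V⁻¹ * Nᵀ = fromBlocks (P * Cᵀ * V⁻¹ * C * P) (P * Cᵀ * BKᵀ) (BK * C * P)
      (BK * V * BKᵀ) := by
    rw [hN, Matrix.transpose_fromRows, Matrix.fromRows_mul, Matrix.fromRows_mul_fromCols]
    simp only [Matrix.transpose_mul, Matrix.transpose_transpose, hPs, hVs]
    rw [Matrix.fromBlocks_inj]
    refine ⟨by simp only [Matrix.mul_assoc], ?_, ?_, ?_⟩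
    · rw [Matrix.mul_assoc _ V⁻¹, Matrix.nonsing_inv_mul_cancel_left _ _ hVdet]
    · rw [Matrix.mul_assoc BK, Matrix.mul_nonsing_inv _ hVdet, Matrix.mul_one]
      simp only [Matrix.mul_assoc]
    · rw [Matrix.mul_assoc BK, Matrix.mul_nonsing_inv _ hVdet, Matrix.mul_one]
      simp only [Matrix.mul_assoc]
  have hD : (fromBlocks (X₁₁ - P) X₁₂ X₂₁ X₂₂).PosSemidef := by
    refine hM.posSemidef_of_lyapunov hNpos ?_
    rw [hNeq, ← hP, ← h, ← sub_eq_zero]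
    simp only [Matrix.fromBlocks_transpose, Matrix.fromBlocks_multiply, Matrix.fromBlocks_add,
      sub_eq_add_neg, Matrix.fromBlocks_neg, ← Matrix.fromBlocks_zero, Matrix.fromBlocks_inj]
    refine ⟨?_, ?_, ?_, ?_⟩ <;>
    · simp only [Matrix.mul_add, Matrix.add_mul, Matrix.mul_neg, Matrix.neg_mul,
        Matrix.transpose_mul, Matrix.mul_assoc]
      abel
  have hE := hR.posSemidef.trace_mul_nonneg (hD.mul_mul_conjTranspose_same (Matrix.fromCols F CK))
  rw [Matrix.conjTranspose_eq_transpose_of_trivial, Matrix.transpose_fromCols,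
    Matrix.fromCols_mul_fromBlocks, Matrix.fromCols_mul_fromRows] at hE
  rw [← sub_nonneg, ← Matrix.trace_sub]
  refine hE.trans_eq (congrArg Matrix.trace ?_)
  simp only [Matrix.mul_add, Matrix.add_mul, Matrix.mul_sub, Matrix.sub_mul, Matrix.mul_assoc]
  abel

/-- A minimal stationary controller is no more expensive than any stabilizing controller. -/
theorem Matrix.trace_cost_le_of_stationary
    {A AK Q W X₁₁ X₁₂ X₂₁ X₂₂ Y₁₁ Y₁₂ Y₂₁ Y₂₂ AL Z₁₁ Z₁₂ Z₂₁ Z₂₂ : Matrix (Fin n) (Fin n) ℝ}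
    {B : Matrix (Fin n) (Fin m) ℝ} {C : Matrix (Fin p) (Fin n) ℝ} {BK BL : Matrix (Fin n) (Fin p) ℝ}
    {CK CL : Matrix (Fin m) (Fin n) ℝ} {R : Matrix (Fin m) (Fin m) ℝ} {V : Matrix (Fin p) (Fin p) ℝ}
    (hX : fromBlocks A (B * CK) (BK * C) AK * fromBlocks X₁₁ X₁₂ X₂₁ X₂₂
      + fromBlocks X₁₁ X₁₂ X₂₁ X₂₂ * (fromBlocks A (B * CK) (BK * C) AK)ᵀ
      + fromBlocks W 0 0 (BK * V * BKᵀ) = 0)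
    (hY : (fromBlocks A (B * CK) (BK * C) AK)ᵀ * fromBlocks Y₁₁ Y₁₂ Y₂₁ Y₂₂
      + fromBlocks Y₁₁ Y₁₂ Y₂₁ Y₂₂ * fromBlocks A (B * CK) (BK * C) AK
      + fromBlocks Q 0 0 (CKᵀ * R * CK) = 0)
    (hL : IsStableMatrix (fromBlocks A (B * CL) (BL * C) AL))
    (hZ : fromBlocks A (B * CL) (BL * C) AL * fromBlocks Z₁₁ Z₁₂ Z₂₁ Z₂₂
      + fromBlocks Z₁₁ Z₁₂ Z₂₁ Z₂₂ * (fromBlocks A (B * CL) (BL * C) AL)ᵀ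
      + fromBlocks W 0 0 (BL * V * BLᵀ) = 0)
    (hR : R.PosDef) (hV : V.PosDef)
    (hX₁₁ : X₁₁ᵀ = X₁₁) (hX₂₁ : X₂₁ = X₁₂ᵀ) (hX₂₂ : X₂₂.PosDef)
    (hY₁₁ : Y₁₁ᵀ = Y₁₁) (hY₂₁ : Y₂₁ = Y₁₂ᵀ) (hY₂₂ : Y₂₂.PosDef)
    (hgA : Y₂₁ * X₁₂ + Y₂₂ * X₂₂ = 0)
    (hgB : (Y₂₁ * X₁₁ + Y₂₂ * X₂₁) * Cᵀ + Y₂₂ * BK * V = 0)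
    (hgC : Bᵀ * (Y₁₁ * X₁₂ + Y₁₂ * X₂₂) + R * CK * X₂₂ = 0) :
    (Q * X₁₁).trace + (CKᵀ * R * CK * X₂₂).trace ≤
      (Q * Z₁₁).trace + (CLᵀ * R * CL * Z₂₂).trace := by
  have dX : IsUnit X₂₂.det := (Matrix.isUnit_iff_isUnit_det _).1 hX₂₂.isUnit
  have dY : IsUnit Y₂₂.det := (Matrix.isUnit_iff_isUnit_det _).1 hY₂₂.isUnit
  have dR : IsUnit R.det := (Matrix.isUnit_iff_isUnit_det _).1 hR.isUnit
  have dV : IsUnit V.det := (Matrix.isUnit_iff_isUnit_det _).1 hV.isUnit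
  have sX : X₂₂ᵀ = X₂₂ := hX₂₂.isHermitian
  have sY : Y₂₂ᵀ = Y₂₂ := hY₂₂.isHermitian
  have sR : Rᵀ = R := hR.isHermitian
  have sV : Vᵀ = V := hV.isHermitian
  have siX : X₂₂⁻¹ᵀ = X₂₂⁻¹ := by rw [Matrix.transpose_nonsing_inv, sX]
  have siY : Y₂₂⁻¹ᵀ = Y₂₂⁻¹ := by rw [Matrix.transpose_nonsing_inv, sY]
  subst hX₂₁ hY₂₁
  -- `T ξ` is the linear regression of `x` on `ξ`, and the Schur complement `P` below is its error
  -- covariance; `U` and `S` are the duals for the adjoint equation.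
  set T := X₁₂ * X₂₂⁻¹ with hT
  set U := Y₁₂ * Y₂₂⁻¹ with hU
  have eX : X₁₂ = T * X₂₂ := by rw [hT, Matrix.nonsing_inv_mul_cancel_right _ _ dX]
  have eY : Y₁₂ = U * Y₂₂ := by rw [hU, Matrix.nonsing_inv_mul_cancel_right _ _ dY]
  have eX' : X₁₂ᵀ = X₂₂ * Tᵀ := by rw [eX, Matrix.transpose_mul, sX]
  have eY' : Y₁₂ᵀ = Y₂₂ * Uᵀ := by rw [eY, Matrix.transpose_mul, sY]
  have hUT : Uᵀ * T = -1 := by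
    have h1 : Y₂₂ * (Uᵀ * T + 1) * X₂₂ = 0 := by
      rw [← hgA, eY', eX]
      simp only [Matrix.mul_add, Matrix.add_mul, Matrix.mul_assoc, Matrix.mul_one]
    have h2 : Uᵀ * T + 1 = Y₂₂⁻¹ * (Y₂₂ * (Uᵀ * T + 1) * X₂₂) * X₂₂⁻¹ := by
      rw [Matrix.mul_assoc Y₂₂, Matrix.nonsing_inv_mul_cancel_left _ _ dY,
        Matrix.mul_nonsing_inv_cancel_right _ _ dX]
    rw [h1] at h2
    exact eq_neg_of_add_eq_zero_left (by simpa using h2)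
  -- `T` and `U` are square because the controller has full order, so a one-sided inverse is
  -- two-sided.
  have hTU : T * Uᵀ = -1 := by
    have := mul_eq_one_comm.1 (show -Uᵀ * T = 1 by rw [Matrix.neg_mul, hUT, neg_neg])
    rw [Matrix.mul_neg] at this
    exact neg_eq_iff_eq_neg.1 this
  have hTU' : U * Tᵀ = -1 := by
    have := congrArg Matrix.transpose hTU
    simpa using this
  set P := X₁₁ - T * X₂₂ * Tᵀ with hP
  set S := Y₁₁ - U * Y₂₂ * Uᵀ with hS
  have sP : Pᵀ = P := by
    rw [hP]; simp only [Matrix.transpose_sub, Matrix.transpose_mul, Matrix.transpose_transpose,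
      hX₁₁, sX, Matrix.mul_assoc]
  have sS : Sᵀ = S := by
    rw [hS]; simp only [Matrix.transpose_sub, Matrix.transpose_mul, Matrix.transpose_transpose,
      hY₁₁, sY, Matrix.mul_assoc]
  have eX₁₁ : X₁₁ = P + T * X₂₂ * Tᵀ := by rw [hP]; abel
  have eY₁₁ : Y₁₁ = S + U * Y₂₂ * Uᵀ := by rw [hS]; abel
  have hTB : T * BK * V = P * Cᵀ := by
    have h1 : Y₂₂ * ((Uᵀ * X₁₁ + X₂₂ * Tᵀ) * Cᵀ + BK * V) = 0 := by
      rw [← hgB, eY', eX']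
      simp only [Matrix.mul_add, Matrix.add_mul, Matrix.mul_assoc]
    have h2 := congrArg (fun N => T * (Y₂₂⁻¹ * N)) h1
    simp only [Matrix.nonsing_inv_mul_cancel_left _ _ dY, Matrix.mul_zero] at h2
    rw [Matrix.mul_add, ← Matrix.mul_assoc T (_ + _) Cᵀ, Matrix.mul_add,
      ← Matrix.mul_assoc T Uᵀ X₁₁, hTU] at h2
    rw [← sub_eq_zero, ← h2, hP]
    simp only [Matrix.add_mul, Matrix.sub_mul, Matrix.neg_mul, Matrix.one_mul, Matrix.mul_assoc]
    abel
  have hCK : R * CK = -(Bᵀ * S * T) := by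
    have h1 : (Bᵀ * (Y₁₁ * T + Y₁₂) + R * CK) * X₂₂ = 0 := by
      rw [← hgC, eX]
      simp only [Matrix.mul_add, Matrix.add_mul, Matrix.mul_assoc]
    have h2 := congrArg (fun N => N * X₂₂⁻¹) h1
    simp only [Matrix.mul_nonsing_inv_cancel_right _ _ dX, Matrix.zero_mul] at h2
    rw [← sub_eq_zero, ← h2, hS, eY]
    simp only [Matrix.mul_add, Matrix.mul_sub, Matrix.sub_mul, Matrix.mul_assoc,
      hUT, Matrix.mul_neg, Matrix.mul_one]
    abel
  have hUC : U * CKᵀ * R = S * B := by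
    have h1 := congrArg Matrix.transpose hCK
    simp only [Matrix.transpose_mul, Matrix.transpose_neg, Matrix.transpose_transpose, sR, sS] at h1
    rw [Matrix.mul_assoc, h1, Matrix.mul_neg, ← Matrix.mul_assoc, hTU', Matrix.neg_mul, neg_neg,
      Matrix.one_mul]
  have ricP := Matrix.riccati_of_lyapunov hX dX sV sP eX eX' eX₁₁ hTB
  -- The adjoint equation is the Lyapunov equation of the dual plant, with `B`, `C` and `B_K`, `C_K`
  -- exchanged and transposed; this reuses `Matrix.riccati_of_lyapunov` for `S`.
  have hY' : fromBlocks Aᵀ (Cᵀ * BKᵀ) (CKᵀ * Bᵀ) AKᵀ * fromBlocks Y₁₁ Y₁₂ Y₁₂ᵀ Y₂₂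
      + fromBlocks Y₁₁ Y₁₂ Y₁₂ᵀ Y₂₂ * (fromBlocks Aᵀ (Cᵀ * BKᵀ) (CKᵀ * Bᵀ) AKᵀ)ᵀ
      + fromBlocks Q 0 0 (CKᵀ * R * CKᵀᵀ) = 0 := by
    rw [← hY]
    simp only [Matrix.fromBlocks_transpose, Matrix.transpose_mul, Matrix.transpose_transpose]
  have ricS := Matrix.riccati_of_lyapunov hY' dY sR sS eY eY' eY₁₁
    (by rw [Matrix.transpose_transpose]; exact hUC)
  simp only [Matrix.transpose_transpose] at ricS
  set F := R⁻¹ * (Bᵀ * S) with hF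
  have hRF : R * F = Bᵀ * S := Matrix.mul_nonsing_inv_cancel_left _ _ dR
  have hFR : Fᵀ * R = S * B := by
    have := congrArg Matrix.transpose hRF
    simpa [Matrix.transpose_mul, sR, sS] using this
  have hCF : CK = -(F * T) := by
    have := congrArg (fun N => R⁻¹ * N) hCK
    simp only [Matrix.nonsing_inv_mul_cancel_left _ _ dR] at this
    rw [this, hF, Matrix.mul_neg]
    simp only [Matrix.mul_assoc]
  have ricS' : Aᵀ * S + S * A + Q = Fᵀ * R * F := by
    rw [ricS, hFR, hCF]
    simp only [Matrix.mul_assoc, Matrix.neg_mul, Matrix.mul_neg]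
    have : T * Uᵀ = -1 := hTU
    rw [this]
    simp
  have ricP' : A * P + P * Aᵀ + W = P * Cᵀ * V⁻¹ * C * P := by
    have hBT : BKᵀ * Tᵀ = V⁻¹ * (C * P) := by
      have h1 := congrArg (fun N => V⁻¹ * Nᵀ) hTB
      simp only [Matrix.transpose_mul, sV, sP, Matrix.transpose_transpose,
        Matrix.nonsing_inv_mul_cancel_left _ _ dV] at h1
      exact h1
    rw [ricP, Matrix.mul_assoc (P * Cᵀ), hBT]
    simp only [Matrix.mul_assoc]
  -- The Riccati pair of the stationary controller bounds the cost of its competitor; equality at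
  -- the stationary one follows from `C_K = -F T`.
  refine le_trans (le_of_eq ?_) (Matrix.le_trace_cost_of_riccati hL hZ hR hV sP ricS' hRF hFR ricP')
  have h11 : A * X₁₁ + B * CK * X₁₂ᵀ + (X₁₁ * Aᵀ + X₁₂ * (B * CK)ᵀ) + W = 0 := by
    rw [Matrix.fromBlocks_transpose, Matrix.fromBlocks_multiply, Matrix.fromBlocks_multiply,
      Matrix.fromBlocks_add, Matrix.fromBlocks_add, ← Matrix.fromBlocks_zero,
      Matrix.fromBlocks_inj] at hX
    exact hX.1
  rw [Matrix.trace_cost_eq_of_riccati h11 ricS' hRF hFR]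
  congr 3
  rw [hCF, eX', eX, hP]
  simp only [Matrix.transpose_neg, Matrix.transpose_mul, Matrix.mul_sub, Matrix.sub_mul,
    Matrix.mul_neg, Matrix.neg_mul, Matrix.mul_assoc]
  abel

end Algebra

/-! ### The average cost as a trace. -/

section Cost

namespace LQGProblem

variable {n m p : ℕ}

/-- The state matrix of the closed loop. -/
def closedLoop (S : LQGProblem n m p) (K : Controller n m p) :
    Matrix (Fin n ⊕ Fin n) (Fin n ⊕ Fin n) ℝ :=
  Matrix.fromBlocks S.A (S.B * K.CK) (K.BK * S.C) K.AK

/-- The intensity of the noise driving the closed loop. -/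
def noiseIntensity (S : LQGProblem n m p) (K : Controller n m p) :
    Matrix (Fin n ⊕ Fin n) (Fin n ⊕ Fin n) ℝ :=
  Matrix.fromBlocks S.W 0 0 (K.BK * S.V * K.BKᵀ)

/-- The weight of the running cost in terms of the closed-loop state. -/
def costWeight (S : LQGProblem n m p) (K : Controller n m p) :
    Matrix (Fin n ⊕ Fin n) (Fin n ⊕ Fin n) ℝ :=
  Matrix.fromBlocks S.Q 0 0 (K.CKᵀ * S.R * K.CK)

theorem _root_.Matrix.PosSemidef.fromBlocks_diagonal {ι κ : Type*} [Fintype ι] [Fintype κ]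
    {A : Matrix ι ι ℝ} {D : Matrix κ κ ℝ} (hA : A.PosSemidef) (hD : D.PosSemidef) :
    (Matrix.fromBlocks A 0 0 D).PosSemidef := by
  refine Matrix.PosSemidef.of_dotProduct_mulVec_nonneg
    (Matrix.IsHermitian.fromBlocks hA.1 (by simp) hD.1) fun x => ?_
  have h1 := hA.dotProduct_mulVec_nonneg (x ∘ Sum.inl)
  have h2 := hD.dotProduct_mulVec_nonneg (x ∘ Sum.inr)
  rw [Matrix.fromBlocks_mulVec]
  simp only [star_trivial, dotProduct, Function.comp_apply, Fintype.sum_sum_type, Sum.elim_inl,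
    Sum.elim_inr, Matrix.zero_mulVec, add_zero, zero_add] at h1 h2 ⊢
  exact add_nonneg h1 h2

theorem Admissible.posSemidef_noiseIntensity {S : LQGProblem n m p} (hS : S.Admissible)
    (K : Controller n m p) : (S.noiseIntensity K).PosSemidef :=
  hS.posSemidef_W.fromBlocks_diagonal (hS.posDef_V.posSemidef.mul_mul_conjTranspose_same K.BK)

theorem Admissible.posSemidef_costWeight {S : LQGProblem n m p} (hS : S.Admissible)
    (K : Controller n m p) : (S.costWeight K).PosSemidef :=
  hS.posSemidef_Q.fromBlocks_diagonal (hS.posDef_R.posSemidef.conjTranspose_mul_mul_same K.CK)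

theorem IsClosedLoopPath.eq_integral {S : LQGProblem n m p} {K : Controller n m p}
    {w : ℝ≥0 → EuclideanSpace ℝ (Fin n)} {v : ℝ≥0 → EuclideanSpace ℝ (Fin p)}
    {x ξ : ℝ → Fin n → ℝ} (h : S.IsClosedLoopPath K w v x ξ) (t : ℝ≥0) :
    Sum.elim (x t) (ξ t) = Sum.elim (x 0) (ξ 0) +
      (∫ s in (0 : ℝ)..t, S.closedLoop K *ᵥ Sum.elim (x s) (ξ s)) +
      Sum.elim (w t).ofLp (K.BK *ᵥ (v t).ofLp) := by
  have hsub : Set.uIcc (0 : ℝ) t ⊆ Set.Ici 0 := by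
    have ht0 : (0 : ℝ) ≤ t := t.2
    rw [Set.uIcc_of_le ht0]; exact Set.Icc_subset_Ici_self
  have hx := h.continuousOn_x.mono hsub
  have hξ := h.continuousOn_xi.mono hsub
  have hmv : ∀ {k l : ℕ} (A : Matrix (Fin k) (Fin l) ℝ) {f : ℝ → Fin l → ℝ},
      ContinuousOn f (Set.uIcc (0 : ℝ) t) → ContinuousOn (fun s => A *ᵥ f s) (Set.uIcc (0 : ℝ) t) :=
    fun A f hf => (continuous_const.matrix_mulVec continuous_id).comp_continuousOn hf
  have eM : ∀ s, S.closedLoop K *ᵥ Sum.elim (x s) (ξ s) =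
      Sum.elim (S.A *ᵥ x s + S.B *ᵥ (K.CK *ᵥ ξ s)) (K.BK *ᵥ (S.C *ᵥ x s) + K.AK *ᵥ ξ s) := by
    intro s
    rw [closedLoop, Matrix.fromBlocks_mulVec]
    simp [Matrix.mulVec_mulVec]
  have c1 : ContinuousOn (fun s => S.A *ᵥ x s + S.B *ᵥ (K.CK *ᵥ ξ s)) (Set.uIcc (0 : ℝ) t) :=
    (hmv _ hx).add (hmv _ (hmv _ hξ))
  have c2 : ContinuousOn (fun s => K.BK *ᵥ (S.C *ᵥ x s)) (Set.uIcc (0 : ℝ) t) := hmv _ (hmv _ hx)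
  have c3 : ContinuousOn (fun s => K.AK *ᵥ ξ s) (Set.uIcc (0 : ℝ) t) := hmv _ hξ
  have i1 := c1.intervalIntegrable (μ := volume)
  have i2 := c2.intervalIntegrable (μ := volume)
  have i3 := c3.intervalIntegrable (μ := volume)
  have i4 := (hmv S.C hx).intervalIntegrable (μ := volume)
  have hI : ∀ {κ : Type} [Fintype κ] {f : ℝ → κ → ℝ}, IntervalIntegrable f volume 0 t → ∀ i,
      (∫ s in (0 : ℝ)..t, f s) i = ∫ s in (0 : ℝ)..t, f s i := fun {κ _ f} hf i =>
    ((ContinuousLinearMap.proj (R := ℝ) (φ := fun _ : κ => ℝ) i).intervalIntegral_comp_comm hf).symm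
  have i0 : IntervalIntegrable (fun s => S.closedLoop K *ᵥ Sum.elim (x s) (ξ s)) volume 0 t := by
    simp only [eM]
    refine ContinuousOn.intervalIntegrable (continuousOn_pi.2 ?_)
    rintro (i | i)
    · exact (continuous_apply i).comp_continuousOn c1
    · exact (continuous_apply i).comp_continuousOn (c2.add c3)
  have hBC : (∫ s in (0 : ℝ)..t, K.BK *ᵥ (S.C *ᵥ x s)) =
      K.BK *ᵥ ∫ s in (0 : ℝ)..t, S.C *ᵥ x s :=
    (LinearMap.toContinuousLinearMap (Matrix.mulVecLin K.BK)).intervalIntegral_comp_comm i4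
  ext (i | i)
  · have h1 := congrFun (h.plant t) i
    simp only [Pi.add_apply] at h1
    simp only [Pi.add_apply, Sum.elim_inl]
    rw [hI i0]
    simp only [eM, Sum.elim_inl]
    rw [h1, hI i1]
  · have h1 := congrFun (h.controller t) i
    rw [Matrix.mulVec_add, ← hBC] at h1
    simp only [Pi.add_apply] at h1
    simp only [Pi.add_apply, Sum.elim_inr]
    rw [hI i0]
    simp only [eM, Sum.elim_inr, Pi.add_apply]
    have a1 : IntervalIntegrable (fun s => (K.BK *ᵥ (S.C *ᵥ x s)) i) volume 0 t :=
      ((continuous_apply i).comp_continuousOn c2).intervalIntegrable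
    have a2 : IntervalIntegrable (fun s => (K.AK *ᵥ ξ s) i) volume 0 t :=
      ((continuous_apply i).comp_continuousOn c3).intervalIntegrable
    rw [intervalIntegral.integral_add a1 a2, ← hI i2, ← hI i3, h1]
    ring

/-- Factoring the weight as `Gᵀ G` writes the running cost as a sum of squares of scalar components
of the state, to which the scalar second-moment results apply. -/
theorem runningCost_integrand_eq {S : LQGProblem n m p} {K : Controller n m p}
    {G : Matrix (Fin n ⊕ Fin n) (Fin n ⊕ Fin n) ℝ} (hG : S.costWeight K = Gᵀ * G)
    (x ξ : Fin n → ℝ) : x ⬝ᵥ (S.Q *ᵥ x) + (K.CK *ᵥ ξ) ⬝ᵥ (S.R *ᵥ (K.CK *ᵥ ξ)) =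
      ∑ l, (G l ⬝ᵥ Sum.elim x ξ) ^ 2 := by
  have h1 : (Sum.elim x ξ) ⬝ᵥ (S.costWeight K *ᵥ Sum.elim x ξ) =
      x ⬝ᵥ (S.Q *ᵥ x) + (K.CK *ᵥ ξ) ⬝ᵥ (S.R *ᵥ (K.CK *ᵥ ξ)) := by
    rw [costWeight, Matrix.fromBlocks_mulVec, Matrix.mul_assoc, ← Matrix.mulVec_mulVec,
      ← Matrix.mulVec_mulVec]
    simp only [Sum.elim_comp_inl, Sum.elim_comp_inr, Matrix.zero_mulVec, add_zero, zero_add,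
      sumElim_dotProduct_sumElim]
    rw [Matrix.dotProduct_mulVec ξ, Matrix.vecMul_transpose]
  rw [← h1, hG, ← Matrix.mulVec_mulVec, Matrix.dotProduct_mulVec, Matrix.vecMul_transpose]
  simp only [dotProduct, Matrix.mulVec, sq]

theorem Admissible.tendsto_averageCost {S : LQGProblem n m p} (hS : S.Admissible)
    {Ω : Type*} [MeasurableSpace Ω] {P : Measure Ω} [IsProbabilityMeasure P]
    {w : ℝ≥0 → Ω → EuclideanSpace ℝ (Fin n)} {v : ℝ≥0 → Ω → EuclideanSpace ℝ (Fin p)}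
    (hw : IsWienerProcess S.W w P) (hv : IsWienerProcess S.V v P)
    (hwv : IndepFun (fun ω t => w t ω) (fun ω t => v t ω) P)
    {K : Controller n m p} (hK : K ∈ S.stabilizing) {x ξ : ℝ → Ω → Fin n → ℝ}
    (hx0 : MemLp (x 0) 2 P) (hξ0 : MemLp (ξ 0) 2 P)
    (hpath : ∀ᵐ ω ∂P, S.IsClosedLoopPath K (fun t => w t ω) (fun t => v t ω)
      (fun t => x t ω) (fun t => ξ t ω))
    {X : Matrix (Fin n ⊕ Fin n) (Fin n ⊕ Fin n) ℝ}
    (hX : S.closedLoop K * X + X * (S.closedLoop K)ᵀ + S.noiseIntensity K = 0) :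
    (∀ T : ℝ, 0 ≤ T →
      Integrable (fun ω => S.runningCost K (fun t => x t ω) (fun t => ξ t ω) T) P) ∧
    Tendsto (S.averageCost K P x ξ) atTop (𝓝 (S.costWeight K * X).trace) := by
  obtain ⟨N, hN, hNwv⟩ := exists_isNoise_of_isWienerProcess hS.posSemidef_W
    hS.posDef_V.posSemidef hw hv hwv K.BK
  obtain ⟨G, hG⟩ := (hS.posSemidef_costWeight K).exists_eq_transpose_mul_self
  -- A measurable representative of the initial state, which is only almost everywhere strongly
  -- measurable.
  set z₀ : Ω → Fin n ⊕ Fin n → ℝ := fun ω => Sum.elim (hx0.1.mk _ ω) (hξ0.1.mk _ ω) with hz₀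
  have hzm : Measurable z₀ := by
    refine measurable_pi_lambda _ ?_
    rintro (i | i)
    · exact (measurable_pi_apply i).comp hx0.1.stronglyMeasurable_mk.measurable
    · exact (measurable_pi_apply i).comp hξ0.1.stronglyMeasurable_mk.measurable
  have hzL : ∀ i, MemLp (fun ω => z₀ ω i) 2 P := by
    rintro (i | i)
    · exact (hx0.ae_eq hx0.1.ae_eq_mk).continuousLinearMap_comp
        (ContinuousLinearMap.proj (R := ℝ) (φ := fun _ : Fin n => ℝ) i)
    · exact (hξ0.ae_eq hξ0.1.ae_eq_mk).continuousLinearMap_comp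
        (ContinuousLinearMap.proj (R := ℝ) (φ := fun _ : Fin n => ℝ) i)
  have hSig : (S.noiseIntensity K)ᵀ = S.noiseIntensity K := (hS.posSemidef_noiseIntensity K).1
  have hM : IsStableMatrix (S.closedLoop K) := hK
  have key := fun l => hN.average_stateResponse_sq hSig hM hX hzm hzL (G l)
  have hcost : ∀ᵐ ω ∂P, ∀ T : ℝ, 0 ≤ T →
      S.runningCost K (fun t => x t ω) (fun t => ξ t ω) T =
        ∑ l, ∫ t in (0 : ℝ)..T, (S.closedLoop K).stateResponse N z₀ (G l) t ω ^ 2 := by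
    filter_upwards [hpath, hNwv, hx0.1.ae_eq_mk, hξ0.1.ae_eq_mk] with ω h1 h2 h3 h4 T hT
    have hz : ContinuousOn (fun t => Sum.elim (x t ω) (ξ t ω)) (Set.Ici 0) := by
      refine continuousOn_pi.2 ?_
      rintro (i | i)
      · exact (continuous_apply i).comp_continuousOn h1.continuousOn_x
      · exact (continuous_apply i).comp_continuousOn h1.continuousOn_xi
    have hvar := fun (c : Fin n ⊕ Fin n → ℝ) (t : ℝ) (ht : 0 ≤ t) =>
      (S.closedLoop K).variation_of_constants (ν := fun t => N t ω) hz (fun t ht => by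
        lift t to ℝ≥0 using ht
        simp only [h2 t]
        exact h1.eq_integral t) c ht
    have hint : ∀ l, IntervalIntegrable
        (fun t => (S.closedLoop K).stateResponse N z₀ (G l) t ω ^ 2) volume 0 T := fun l =>
      ((hN.continuous_stateResponse (G l) ω).pow 2).intervalIntegrable _ _
    rw [← intervalIntegral.integral_finsetSum fun l _ => hint l]
    refine intervalIntegral.integral_congr fun t ht => ?_
    rw [Set.uIcc_of_le hT] at ht
    simp only
    rw [runningCost_integrand_eq hG]
    refine Finset.sum_congr rfl fun l _ => ?_
    rw [hvar (G l) t ht.1]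
    simp only [Matrix.stateResponse, Matrix.noiseResponse, hz₀, ← h3, ← h4]
  refine ⟨fun T hT => ?_, ?_⟩
  · refine (integrable_finsetSum Finset.univ fun l _ => (key l).1 T hT).congr ?_
    filter_upwards [hcost] with ω h using (h T hT).symm
  · have hlim := tendsto_finsetSum Finset.univ fun l _ => (key l).2
    have htr : ∑ l, G l ⬝ᵥ (X *ᵥ G l) = (S.costWeight K * X).trace := by
      rw [hG, Matrix.mul_assoc, Matrix.trace_mul_comm]
      simp only [Matrix.trace, Matrix.diag_apply, Matrix.mul_apply, dotProduct, Matrix.mulVec,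
        Finset.sum_mul, Finset.mul_sum, Matrix.transpose_apply]
      refine Finset.sum_congr rfl fun l _ => ?_
      rw [Finset.sum_comm]
      simp only [mul_assoc]
    rw [htr] at hlim
    refine hlim.congr' ?_
    filter_upwards [eventually_ge_atTop 0] with T hT
    rw [averageCost, ← Finset.mul_sum, ← integral_finsetSum _ fun l _ => (key l).1 T hT]
    congr 1
    refine integral_congr_ae ?_
    filter_upwards [hcost] with ω h using (h T hT).symm

end LQGProblem

end Cost

/-! ### Smooth dependence of Lyapunov solutions. -/

section LyapunovSolution

variable {ι : Type*} [Fintype ι] [DecidableEq ι]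

/-- The Lyapunov operator on arrays of reals. -/
noncomputable def Matrix.lyapunovCLM : Matrix ι ι ℝ →ₗ[ℝ] (ι → ι → ℝ) →L[ℝ] (ι → ι → ℝ) where
  toFun M := LinearMap.toContinuousLinearMap
    ((Matrix.ofLinearEquiv ℝ).symm.toLinearMap ∘ₗ M.lyapunov ∘ₗ
      (Matrix.ofLinearEquiv ℝ).toLinearMap)
  map_add' A B := by
    ext X i j
    simp [Matrix.add_mul, Matrix.mul_add]
    abel
  map_smul' a A := by
    ext X i j
    simp [mul_add]

/-- The solution `X` of `M X + X Mᵀ + N = 0`, if the Lyapunov operator of `M` is invertible. -/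
noncomputable def Matrix.lyapunovSol (M N : Matrix ι ι ℝ) : Matrix ι ι ℝ :=
  Matrix.of (-(Matrix.lyapunovCLM M).inverse (Matrix.of.symm N))

theorem IsStableMatrix.exists_equiv {M : Matrix ι ι ℝ} (hM : IsStableMatrix M) :
    ∃ e : (ι → ι → ℝ) ≃L[ℝ] (ι → ι → ℝ),
      (e : (ι → ι → ℝ) →L[ℝ] (ι → ι → ℝ)) = Matrix.lyapunovCLM M :=
  ⟨((Matrix.ofLinearEquiv ℝ).trans ((LinearEquiv.ofBijective M.lyapunov hM.lyapunov_bijective).trans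
    (Matrix.ofLinearEquiv ℝ).symm)).toContinuousLinearEquiv, rfl⟩

theorem IsStableMatrix.lyapunovSol_spec {M : Matrix ι ι ℝ} (hM : IsStableMatrix M)
    (N : Matrix ι ι ℝ) : M * M.lyapunovSol N + M.lyapunovSol N * Mᵀ + N = 0 := by
  obtain ⟨e, he⟩ := hM.exists_equiv
  have h : Matrix.lyapunovCLM M (Matrix.of.symm (M.lyapunovSol N)) = -Matrix.of.symm N := by
    rw [Matrix.lyapunovSol, ← he, ContinuousLinearMap.inverse_equiv]
    simp
  rw [show M * M.lyapunovSol N + M.lyapunovSol N * Mᵀ = -N from h, neg_add_cancel]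

/-- The Lyapunov operator is linear in `M`, and inversion of continuous linear maps is smooth at an
invertible one, which stability guarantees. -/
theorem ContDiffAt.lyapunovSol {E : Type*} [NormedAddCommGroup E] [NormedSpace ℝ E]
    {M N : E → Matrix ι ι ℝ} {k : E} {r : ℕ∞} (hM : ∀ i j, ContDiffAt ℝ r (fun k => M k i j) k)
    (hN : ∀ i j, ContDiffAt ℝ r (fun k => N k i j) k) (hs : IsStableMatrix (M k)) (i j : ι) :
    ContDiffAt ℝ r (fun k => (M k).lyapunovSol (N k) i j) k := by
  have hM' : ContDiffAt ℝ r (fun k => Matrix.of.symm (M k)) k :=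
    contDiffAt_pi.2 fun i => contDiffAt_pi.2 fun j => hM i j
  have hN' : ContDiffAt ℝ r (fun k => Matrix.of.symm (N k)) k :=
    contDiffAt_pi.2 fun i => contDiffAt_pi.2 fun j => hN i j
  obtain ⟨e, he⟩ := hs.exists_equiv
  let Φ : (ι → ι → ℝ) →L[ℝ] (ι → ι → ℝ) →L[ℝ] (ι → ι → ℝ) := LinearMap.toContinuousLinearMap
    (Matrix.lyapunovCLM ∘ₗ (Matrix.ofLinearEquiv ℝ).toLinearMap)
  have h1 : ContDiffAt ℝ r (fun k => Matrix.lyapunovCLM (M k)) k :=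
    Φ.contDiff.contDiffAt.comp k hM'
  have h2 : ContDiffAt ℝ r ContinuousLinearMap.inverse (Matrix.lyapunovCLM (M k)) := by
    rw [← he]
    exact contDiffAt_map_inverse e
  have h3 := ((h2.comp k h1).clm_apply hN').neg
  exact contDiffAt_pi.1 (contDiffAt_pi.1 h3 i) j

end LyapunovSolution

/-! ### Adjoint formula for cost differences. -/

section Trace

variable {ι : Type*} [Fintype ι]

/-- By duality `tr (Q X) = tr (Y N)`. The formula is exact, with the adjoint at the old point and
the covariance at the new one, so continuity of the covariance suffices to extract a derivative. -/
theorem Matrix.trace_lyapunov_sub {M M' X X' N N' Q Q' Y : Matrix ι ι ℝ}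
    (hX : M * X + X * Mᵀ + N = 0) (hX' : M' * X' + X' * M'ᵀ + N' = 0)
    (hY : Mᵀ * Y + Y * M + Q = 0) (hYs : Yᵀ = Y) (hXs : X'ᵀ = X') :
    (Q' * X').trace - (Q * X).trace =
      ((Q' - Q) * X').trace + (Y * (N' - N)).trace + 2 * (Y * (M' - M) * X').trace := by
  have h1 : (Q * X).trace = (Y * N).trace := by
    have a := congrArg (fun Z => (Y * Z).trace) hX
    have b := congrArg (fun Z => (Z * X).trace) hY
    simp only [Matrix.mul_add, Matrix.add_mul, Matrix.trace_add, Matrix.mul_zero, Matrix.zero_mul,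
      Matrix.trace_zero] at a b
    have c : (Y * (X * Mᵀ)).trace = (Mᵀ * Y * X).trace := by
      rw [← Matrix.mul_assoc, Matrix.trace_mul_comm, ← Matrix.mul_assoc]
    rw [c, ← Matrix.mul_assoc] at a
    linarith
  have h2 : (Q * X').trace = -(2 * (Y * M * X').trace) := by
    have b := congrArg (fun Z => (Z * X').trace) hY
    simp only [Matrix.add_mul, Matrix.trace_add, Matrix.zero_mul, Matrix.trace_zero] at b
    have c : (Mᵀ * Y * X').trace = (Y * M * X').trace := by
      rw [← Matrix.trace_transpose, Matrix.transpose_mul, Matrix.transpose_mul, hYs, hXs,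
        Matrix.transpose_transpose, Matrix.trace_mul_comm]
    linarith
  have h3 : (Y * N').trace = -(2 * (Y * M' * X').trace) := by
    have a := congrArg (fun Z => (Y * Z).trace) hX'
    simp only [Matrix.mul_add, Matrix.trace_add, Matrix.mul_zero, Matrix.trace_zero] at a
    have c : (Y * (X' * M'ᵀ)).trace = (Y * (M' * X')).trace := by
      rw [← Matrix.trace_transpose, Matrix.transpose_mul, Matrix.transpose_mul, hYs, hXs,
        Matrix.transpose_transpose, Matrix.trace_mul_comm]
    rw [c, ← Matrix.mul_assoc] at a
    linarith
  simp only [Matrix.sub_mul, Matrix.mul_sub, Matrix.trace_sub]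
  linarith

theorem Matrix.eq_zero_of_forall_trace_mul {κ : Type*} [Fintype κ]
    {Z : Matrix ι κ ℝ} (h : ∀ H : Matrix κ ι ℝ, (Z * H).trace = 0) : Z = 0 := by
  have := h Zᵀ
  rw [← Matrix.conjTranspose_eq_transpose_of_trivial,
    Matrix.trace_mul_conjTranspose_self_eq_zero_iff] at this
  exact this

end Trace

/-! ### Limits of gradient iterations. -/

section Descent

/-- The limit of a gradient-type iteration whose step sizes are not summable is a zero of the
vector field. -/
theorem eq_zero_of_tendsto_descent {E : Type*} [NormedAddCommGroup E] [InnerProductSpace ℝ E]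
    {g : E → E} {K : ℕ → E} {α : ℕ → ℝ} {k : E} (hα : ∀ t, 0 ≤ α t) (hα_sum : ¬ Summable α)
    (hstep : ∀ t, K (t + 1) = K t - α t • g (K t)) (hlim : Tendsto K atTop (𝓝 k))
    (hg : ContinuousAt g k) : g k = 0 := by
  by_contra hne
  have hpos : 0 < inner ℝ (g k) (g k) := real_inner_self_pos.2 hne
  -- Half of `‖g k‖ ^ 2`: eventually every `g (K t)` has inner product with `g k` at least `c`.
  set c := inner ℝ (g k) (g k) / 2 with hc
  have hin : Tendsto (fun t => inner ℝ (g (K t)) (g k)) atTop (𝓝 (inner ℝ (g k) (g k))) :=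
    (hg.tendsto.comp hlim).inner tendsto_const_nhds
  obtain ⟨T, hT⟩ := eventually_atTop.1 (hin.eventually_const_le (show c < _ by linarith))
  -- Telescoping bounds the partial sums of the steps by the displacement along `g k`. Convergence
  -- of `K` keeps that displacement bounded, contradicting non-summability.
  have hsum : ∀ t, c * ∑ s ∈ Finset.range t, α (s + T) ≤ inner ℝ (K T - K (t + T)) (g k) := by
    intro t
    induction t with
    | zero => simp
    | succ t ih =>
      rw [Finset.sum_range_succ, mul_add, show t + 1 + T = t + T + 1 by ring, hstep]
      have h1 : K T - (K (t + T) - α (t + T) • g (K (t + T))) =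
          (K T - K (t + T)) + α (t + T) • g (K (t + T)) := by abel
      rw [h1, inner_add_left, real_inner_smul_left]
      have h2 := mul_le_mul_of_nonneg_left (hT (t + T) (by omega)) (hα (t + T))
      linarith
  have hconv : Tendsto (fun t => inner ℝ (K T - K (t + T)) (g k)) atTop
      (𝓝 (inner ℝ (K T - k) (g k))) :=
    (tendsto_const_nhds.sub (hlim.comp (tendsto_add_atTop_nat T))).inner tendsto_const_nhds
  obtain ⟨b, hb⟩ := hconv.bddAbove_range
  apply hα_sum
  rw [← summable_nat_add_iff T]
  refine summable_of_sum_range_le (c := b / c) (fun t => hα _) fun t => ?_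
  rw [le_div_iff₀' (by linarith)]
  exact (hsum t).trans (hb ⟨t, rfl⟩)

end Descent

/-! ### Smoothness of the trace formula and openness of the stabilizing set. -/

section Gradient

namespace LQGProblem

variable {n m p : ℕ}

theorem contDiff_closedLoop (S : LQGProblem n m p) (r : ℕ∞) (i j : Fin n ⊕ Fin n) :
    ContDiff ℝ r fun K => S.closedLoop K i j := by
  rcases i with i | i <;> rcases j with j | j <;>
    simp only [closedLoop, Matrix.fromBlocks_apply₁₁, Matrix.fromBlocks_apply₁₂,
      Matrix.fromBlocks_apply₂₁, Matrix.fromBlocks_apply₂₂, Matrix.mul_apply, Controller.AK,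
      Controller.BK, Controller.CK, Matrix.of_apply] <;> fun_prop

theorem contDiff_noiseIntensity (S : LQGProblem n m p) (r : ℕ∞) (i j : Fin n ⊕ Fin n) :
    ContDiff ℝ r fun K => S.noiseIntensity K i j := by
  rcases i with i | i <;> rcases j with j | j <;>
    simp only [noiseIntensity, Matrix.fromBlocks_apply₁₁, Matrix.fromBlocks_apply₁₂,
      Matrix.fromBlocks_apply₂₁, Matrix.fromBlocks_apply₂₂, Matrix.mul_apply,
      Controller.BK, Matrix.of_apply, Matrix.transpose_apply, Matrix.zero_apply] <;> fun_prop

theorem contDiff_costWeight (S : LQGProblem n m p) (r : ℕ∞) (i j : Fin n ⊕ Fin n) :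
    ContDiff ℝ r fun K => S.costWeight K i j := by
  rcases i with i | i <;> rcases j with j | j <;>
    simp only [costWeight, Matrix.fromBlocks_apply₁₁, Matrix.fromBlocks_apply₁₂,
      Matrix.fromBlocks_apply₂₁, Matrix.fromBlocks_apply₂₂, Matrix.mul_apply,
      Controller.CK, Matrix.of_apply, Matrix.transpose_apply, Matrix.zero_apply] <;> fun_prop

/-- The stationary covariance of the closed-loop state. -/
noncomputable def covariance (S : LQGProblem n m p) (K : Controller n m p) :
    Matrix (Fin n ⊕ Fin n) (Fin n ⊕ Fin n) ℝ :=
  (S.closedLoop K).lyapunovSol (S.noiseIntensity K)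

theorem contDiffAt_covariance (S : LQGProblem n m p) (r : ℕ∞) {K : Controller n m p}
    (hK : K ∈ S.stabilizing) (i j : Fin n ⊕ Fin n) :
    ContDiffAt ℝ r (fun K => S.covariance K i j) K :=
  ContDiffAt.lyapunovSol (fun i j => (S.contDiff_closedLoop r i j).contDiffAt)
    (fun i j => (S.contDiff_noiseIntensity r i j).contDiffAt) hK i j

theorem covariance_spec (S : LQGProblem n m p) {K : Controller n m p} (hK : K ∈ S.stabilizing) :
    S.closedLoop K * S.covariance K + S.covariance K * (S.closedLoop K)ᵀ + S.noiseIntensity K = 0 :=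
  IsStableMatrix.lyapunovSol_spec hK _

theorem contDiffAt_trace (S : LQGProblem n m p) (r : ℕ∞) {K : Controller n m p}
    (hK : K ∈ S.stabilizing) :
    ContDiffAt ℝ r (fun K => (S.costWeight K * S.covariance K).trace) K := by
  simp only [Matrix.trace, Matrix.diag_apply, Matrix.mul_apply]
  exact ContDiffAt.sum fun i _ => ContDiffAt.sum fun j _ =>
    (S.contDiff_costWeight r i j).contDiffAt.mul (S.contDiffAt_covariance r hK j i)

theorem isOpen_stabilizing (S : LQGProblem n m p) : IsOpen S.stabilizing :=
  isOpen_setOf_isStableMatrix.preimage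
    (continuous_pi fun i => continuous_pi fun j => (S.contDiff_closedLoop 0 i j).continuous)

end LQGProblem

end Gradient

/-! ### First-order conditions and their consequence. -/

section Stationary

variable {n m p : ℕ}

/-- The controller with the given matrices. -/
def Controller.ofMatrices (A : Matrix (Fin n) (Fin n) ℝ) (B : Matrix (Fin n) (Fin p) ℝ)
    (C : Matrix (Fin m) (Fin n) ℝ) : Controller n m p :=
  WithLp.toLp 2 (Sum.elim (fun q => A q.1 q.2) (Sum.elim (fun q => B q.1 q.2) fun q => C q.1 q.2))

theorem Controller.AK_add_smul (K : Controller n m p) (s : ℝ) (A : Matrix (Fin n) (Fin n) ℝ)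
    (B : Matrix (Fin n) (Fin p) ℝ) (C : Matrix (Fin m) (Fin n) ℝ) :
    (K + s • Controller.ofMatrices A B C).AK = K.AK + s • A := rfl

theorem Controller.BK_add_smul (K : Controller n m p) (s : ℝ) (A : Matrix (Fin n) (Fin n) ℝ)
    (B : Matrix (Fin n) (Fin p) ℝ) (C : Matrix (Fin m) (Fin n) ℝ) :
    (K + s • Controller.ofMatrices A B C).BK = K.BK + s • B := rfl

theorem Controller.CK_add_smul (K : Controller n m p) (s : ℝ) (A : Matrix (Fin n) (Fin n) ℝ)
    (B : Matrix (Fin n) (Fin p) ℝ) (C : Matrix (Fin m) (Fin n) ℝ) :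
    (K + s • Controller.ofMatrices A B C).CK = K.CK + s • C := rfl

namespace LQGProblem

/-- Together with the two analogues below, this keeps the increment along a line exact with `s`
factored out, ready for division by `s`. -/
theorem costWeight_add_smul_sub (S : LQGProblem n m p) (K : Controller n m p)
    (A : Matrix (Fin n) (Fin n) ℝ) (B : Matrix (Fin n) (Fin p) ℝ) (C : Matrix (Fin m) (Fin n) ℝ)
    (s : ℝ) : S.costWeight (K + s • Controller.ofMatrices A B C) - S.costWeight K =
      s • (Matrix.fromBlocks 0 0 0 (Cᵀ * S.R * K.CK + K.CKᵀ * S.R * C) +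
        s • Matrix.fromBlocks 0 0 0 (Cᵀ * S.R * C)) := by
  simp only [costWeight, Controller.CK_add_smul, sub_eq_add_neg, Matrix.fromBlocks_neg,
    Matrix.fromBlocks_add, Matrix.fromBlocks_smul, Matrix.fromBlocks_inj]
  refine ⟨by simp, by simp, by simp, ?_⟩
  simp only [Matrix.transpose_add, Matrix.transpose_smul, Matrix.add_mul, Matrix.mul_add,
    Matrix.smul_mul, Matrix.mul_smul, smul_add]
  abel

theorem noiseIntensity_add_smul_sub (S : LQGProblem n m p) (K : Controller n m p)
    (A : Matrix (Fin n) (Fin n) ℝ) (B : Matrix (Fin n) (Fin p) ℝ) (C : Matrix (Fin m) (Fin n) ℝ)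
    (s : ℝ) : S.noiseIntensity (K + s • Controller.ofMatrices A B C) - S.noiseIntensity K =
      s • (Matrix.fromBlocks 0 0 0 (B * S.V * K.BKᵀ + K.BK * S.V * Bᵀ) +
        s • Matrix.fromBlocks 0 0 0 (B * S.V * Bᵀ)) := by
  simp only [noiseIntensity, Controller.BK_add_smul, sub_eq_add_neg, Matrix.fromBlocks_neg,
    Matrix.fromBlocks_add, Matrix.fromBlocks_smul, Matrix.fromBlocks_inj]
  refine ⟨by simp, by simp, by simp, ?_⟩
  simp only [Matrix.transpose_add, Matrix.transpose_smul, Matrix.add_mul, Matrix.mul_add,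
    Matrix.smul_mul, Matrix.mul_smul, smul_add]
  abel

theorem closedLoop_add_smul_sub (S : LQGProblem n m p) (K : Controller n m p)
    (A : Matrix (Fin n) (Fin n) ℝ) (B : Matrix (Fin n) (Fin p) ℝ) (C : Matrix (Fin m) (Fin n) ℝ)
    (s : ℝ) : S.closedLoop (K + s • Controller.ofMatrices A B C) - S.closedLoop K =
      s • Matrix.fromBlocks 0 (S.B * C) (B * S.C) A := by
  simp only [closedLoop, Controller.AK_add_smul, Controller.BK_add_smul,
    Controller.CK_add_smul, sub_eq_add_neg, Matrix.fromBlocks_neg,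
    Matrix.fromBlocks_add, Matrix.fromBlocks_smul, Matrix.fromBlocks_inj]
  refine ⟨by simp, ?_, ?_, by abel⟩ <;>
  · simp only [Matrix.add_mul, Matrix.mul_add, Matrix.smul_mul, Matrix.mul_smul]
    abel

theorem continuousAt_covariance (S : LQGProblem n m p) {K : Controller n m p}
    (hK : K ∈ S.stabilizing) : ContinuousAt S.covariance K :=
  continuousAt_pi.2 fun i => continuousAt_pi.2 fun j =>
    (S.contDiffAt_covariance 0 hK i j).continuousAt

theorem _root_.eq_zero_of_hasDerivAt_of_sub_eq_mul {φ ψ : ℝ → ℝ} (hφ : HasDerivAt φ 0 0)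
    (hψ : ContinuousAt ψ 0) (h : ∀ᶠ s in 𝓝 (0 : ℝ), φ s - φ 0 = s * ψ s) : ψ 0 = 0 := by
  have h1 := hasDerivAt_iff_tendsto_slope.1 hφ
  have h2 : Tendsto ψ (𝓝[≠] 0) (𝓝 (ψ 0)) := hψ.tendsto.mono_left nhdsWithin_le_nhds
  refine tendsto_nhds_unique (h2.congr' ?_) h1
  filter_upwards [nhdsWithin_le_nhds h, self_mem_nhdsWithin] with s hs hs0
  have hs0' : s ≠ 0 := hs0
  rw [slope_def_field, hs, sub_zero, mul_div_cancel_left₀ _ hs0']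

/-- The first-order condition at a point where the cost has zero derivative. -/
theorem Admissible.first_order {S : LQGProblem n m p} (hS : S.Admissible) {K : Controller n m p}
    (hK : K ∈ S.stabilizing)
    (hd : HasFDerivAt (fun K => (S.costWeight K * S.covariance K).trace)
      (0 : Controller n m p →L[ℝ] ℝ) K)
    {Y : Matrix (Fin n ⊕ Fin n) (Fin n ⊕ Fin n) ℝ}
    (hY : (S.closedLoop K)ᵀ * Y + Y * S.closedLoop K + S.costWeight K = 0) (hYs : Yᵀ = Y)
    (A : Matrix (Fin n) (Fin n) ℝ) (B : Matrix (Fin n) (Fin p) ℝ) (C : Matrix (Fin m) (Fin n) ℝ) :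
    (Matrix.fromBlocks 0 0 0 (Cᵀ * S.R * K.CK + K.CKᵀ * S.R * C) * S.covariance K).trace +
      (Y * Matrix.fromBlocks 0 0 0 (B * S.V * K.BKᵀ + K.BK * S.V * Bᵀ)).trace +
      2 * (Y * Matrix.fromBlocks 0 (S.B * C) (B * S.C) A * S.covariance K).trace = 0 := by
  have hQ := S.costWeight_add_smul_sub K A B C
  have hN := S.noiseIntensity_add_smul_sub K A B C
  have hM := S.closedLoop_add_smul_sub K A B C
  generalize Controller.ofMatrices A B C = H at hQ hN hM
  generalize Matrix.fromBlocks 0 0 0 (Cᵀ * S.R * K.CK + K.CKᵀ * S.R * C) = Q₁ at hQ ⊢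
  generalize Matrix.fromBlocks 0 0 0 (Cᵀ * S.R * C) = Q₂ at hQ
  generalize Matrix.fromBlocks 0 0 0 (B * S.V * K.BKᵀ + K.BK * S.V * Bᵀ) = N₁ at hN ⊢
  generalize Matrix.fromBlocks 0 0 0 (B * S.V * Bᵀ) = N₂ at hN
  generalize Matrix.fromBlocks 0 (S.B * C) (B * S.C) A = M₁ at hM ⊢
  have hK0 : K + (0 : ℝ) • H = K := by rw [zero_smul, add_zero]
  have hline : HasDerivAt (fun s : ℝ => K + s • H) H 0 := by
    simpa using ((hasDerivAt_id (0 : ℝ)).smul_const H).const_add K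
  have hφd : HasDerivAt
      (fun s : ℝ => (S.costWeight (K + s • H) * S.covariance (K + s • H)).trace) 0 0 := by
    have h0 : HasFDerivAt (fun K => (S.costWeight K * S.covariance K).trace)
        (0 : Controller n m p →L[ℝ] ℝ) (K + (0 : ℝ) • H) := by rwa [hK0]
    exact h0.comp_hasDerivAt (0 : ℝ) hline
  have hcov : ContinuousAt (fun s : ℝ => S.covariance (K + s • H)) 0 := by
    have h0 : ContinuousAt S.covariance (K + (0 : ℝ) • H) := by
      rw [hK0]; exact S.continuousAt_covariance hK
    exact ContinuousAt.comp (g := S.covariance) (f := fun s : ℝ => K + s • H) h0 hline.continuousAt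
  have hstab : ∀ᶠ s in 𝓝 (0 : ℝ), K + s • H ∈ S.stabilizing :=
    hline.continuousAt.eventually (S.isOpen_stabilizing.mem_nhds (by simpa using hK))
  -- The exact difference formula with base point `K`; the cofactor of `s` is continuous at zero,
  -- and its value there is the directional derivative.
  have hφψ : ∀ᶠ s in 𝓝 (0 : ℝ),
      (S.costWeight (K + s • H) * S.covariance (K + s • H)).trace -
        (S.costWeight (K + (0 : ℝ) • H) * S.covariance (K + (0 : ℝ) • H)).trace =
      s * (((Q₁ + s • Q₂) * S.covariance (K + s • H)).trace + (Y * (N₁ + s • N₂)).trace +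
        2 * (Y * M₁ * S.covariance (K + s • H)).trace) := by
    filter_upwards [hstab] with s hs
    have hXs : (S.covariance (K + s • H))ᵀ = S.covariance (K + s • H) :=
      IsStableMatrix.isSymm_of_lyapunov hs (hS.posSemidef_noiseIntensity _).1 (S.covariance_spec hs)
    have h1 := Matrix.trace_lyapunov_sub (Q' := S.costWeight (K + s • H)) (S.covariance_spec hK)
      (S.covariance_spec hs) hY hYs hXs
    rw [hK0, h1, hQ, hN, hM]
    simp only [Matrix.smul_mul, Matrix.mul_smul, Matrix.trace_smul, smul_eq_mul]
    ring
  have hψc : ContinuousAt (fun s : ℝ => ((Q₁ + s • Q₂) * S.covariance (K + s • H)).trace +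
      (Y * (N₁ + s • N₂)).trace + 2 * (Y * M₁ * S.covariance (K + s • H)).trace) 0 := by
    have hg : Continuous fun q : ℝ × Matrix (Fin n ⊕ Fin n) (Fin n ⊕ Fin n) ℝ =>
        ((Q₁ + q.1 • Q₂) * q.2).trace + (Y * (N₁ + q.1 • N₂)).trace +
          2 * (Y * M₁ * q.2).trace := by
      fun_prop
    exact ContinuousAt.comp (f := fun s : ℝ => (s, S.covariance (K + s • H))) hg.continuousAt
      (continuousAt_id.prodMk hcov)
  have h := eq_zero_of_hasDerivAt_of_sub_eq_mul hφd hψc hφψ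
  simpa only [zero_smul, add_zero] using h

theorem _root_.Matrix.trace_fromBlocks' {ι κ : Type*} [Fintype ι] [Fintype κ] (A : Matrix ι ι ℝ)
    (B : Matrix ι κ ℝ) (C : Matrix κ ι ℝ) (D : Matrix κ κ ℝ) :
    (Matrix.fromBlocks A B C D).trace = A.trace + D.trace := by
  simp [Matrix.trace, Fintype.sum_sum_type]

theorem Admissible.le_of_stationary {S : LQGProblem n m p} (hS : S.Admissible)
    {K L : Controller n m p} (hK : K ∈ S.stabilizing) (hL : L ∈ S.stabilizing)
    (hd : HasFDerivAt (fun K => (S.costWeight K * S.covariance K).trace)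
      (0 : Controller n m p →L[ℝ] ℝ) K)
    (hctrl : IsControllable K.AK K.BK) (hobs : IsObservable K.CK K.AK) :
    (S.costWeight K * S.covariance K).trace ≤ (S.costWeight L * S.covariance L).trace := by
  have hKt : IsStableMatrix (S.closedLoop K)ᵀ := IsStableMatrix.transpose hK
  have hX := S.covariance_spec hK
  have hXp := IsStableMatrix.posSemidef_of_lyapunov hK (hS.posSemidef_noiseIntensity K) hX
  set Y := (S.closedLoop K)ᵀ.lyapunovSol (S.costWeight K) with hYdef
  have hY := hKt.lyapunovSol_spec (S.costWeight K)
  rw [← hYdef] at hY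
  have hYp := hKt.posSemidef_of_lyapunov (hS.posSemidef_costWeight K) hY
  rw [Matrix.transpose_transpose] at hY
  have hfo := hS.first_order hK hd hY hYp.1
  have hZ := S.covariance_spec hL
  have hX22 := Matrix.posDef_toBlocks₂₂_of_isControllable hS.posDef_V hctrl hXp hX
  -- The dual plant again: observability of `(C_K, A_K)` is controllability of the transposed pair,
  -- and `R` takes the place of `V`.
  have hY22 : Y.toBlocks₂₂.PosDef := by
    refine Matrix.posDef_toBlocks₂₂_of_isControllable (A := S.Aᵀ) (B := S.Cᵀ) (CK := K.BKᵀ)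
      (C := S.Bᵀ) (W := S.Q) hS.posDef_R hobs.isControllable hYp ?_
    rw [← hY]
    simp only [closedLoop, costWeight, Matrix.fromBlocks_transpose, Matrix.transpose_mul,
      Matrix.transpose_transpose]
  set X := S.covariance K with hXdef
  set Z := S.covariance L with hZdef
  obtain ⟨X₁₁, X₁₂, X₂₁, X₂₂, hXb⟩ : ∃ X₁₁ X₁₂ X₂₁ X₂₂, X = Matrix.fromBlocks X₁₁ X₁₂ X₂₁ X₂₂ :=
    ⟨_, _, _, _, (Matrix.fromBlocks_toBlocks X).symm⟩
  obtain ⟨Y₁₁, Y₁₂, Y₂₁, Y₂₂, hYb⟩ : ∃ Y₁₁ Y₁₂ Y₂₁ Y₂₂, Y = Matrix.fromBlocks Y₁₁ Y₁₂ Y₂₁ Y₂₂ :=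
    ⟨_, _, _, _, (Matrix.fromBlocks_toBlocks Y).symm⟩
  obtain ⟨Z₁₁, Z₁₂, Z₂₁, Z₂₂, hZb⟩ : ∃ Z₁₁ Z₁₂ Z₂₁ Z₂₂, Z = Matrix.fromBlocks Z₁₁ Z₁₂ Z₂₁ Z₂₂ :=
    ⟨_, _, _, _, (Matrix.fromBlocks_toBlocks Z).symm⟩
  have hXs : Xᵀ = X := hXp.1
  have hYs : Yᵀ = Y := hYp.1
  rw [hXb] at hX hX22 hXs hfo ⊢
  rw [hYb] at hY hY22 hYs hfo
  rw [hZb] at hZ ⊢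
  rw [Matrix.toBlocks_fromBlocks₂₂] at hX22 hY22
  rw [Matrix.fromBlocks_transpose, Matrix.fromBlocks_inj] at hXs hYs
  obtain ⟨sX₁₁, sX₂₁, sX₁₂, sX₂₂⟩ := hXs
  obtain ⟨sY₁₁, sY₂₁, sY₁₂, sY₂₂⟩ := hYs
  have sR : S.Rᵀ = S.R := hS.posDef_R.1
  have sV : S.Vᵀ = S.V := hS.posDef_V.1
  simp only [Matrix.fromBlocks_multiply, Matrix.trace_fromBlocks', Matrix.zero_mul, Matrix.mul_zero,
    zero_add, add_zero] at hfo
  -- Each condition comes from a direction that perturbs a single controller matrix: its trace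
  -- pairing vanishes for every direction, so the cofactor is zero.
  have gA : Y₂₁ * X₁₂ + Y₂₂ * X₂₂ = 0 := by
    have h1 : X₂₁ * Y₁₂ + X₂₂ * Y₂₂ = 0 := by
      refine Matrix.eq_zero_of_forall_trace_mul fun A => ?_
      have h := hfo A 0 0
      simp only [Matrix.transpose_zero, Matrix.zero_mul, Matrix.mul_zero, Matrix.trace_zero,
        zero_add, add_zero] at h
      rw [Matrix.trace_mul_cycle, Matrix.trace_mul_cycle Y₂₂] at h
      rw [Matrix.add_mul, Matrix.trace_add]
      linarith
    have h2 := congrArg Matrix.transpose h1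
    simpa [Matrix.transpose_add, Matrix.transpose_mul, sX₂₂, sY₂₂, sX₁₂, sX₂₁, sY₁₂, sY₂₁] using h2
  have gB : (Y₂₁ * X₁₁ + Y₂₂ * X₂₁) * S.Cᵀ + Y₂₂ * K.BK * S.V = 0 := by
    have h1 : S.C * (X₁₁ * Y₁₂ + X₁₂ * Y₂₂) + S.V * K.BKᵀ * Y₂₂ = 0 := by
      refine Matrix.eq_zero_of_forall_trace_mul fun B => ?_
      have h := hfo 0 B 0
      simp only [Matrix.transpose_zero, Matrix.zero_mul, Matrix.mul_zero, Matrix.trace_zero,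
        zero_add, add_zero] at h
      have h3 : (Y₂₂ * (B * S.V * K.BKᵀ)).trace = (S.V * K.BKᵀ * Y₂₂ * B).trace := by
        rw [Matrix.trace_mul_comm, Matrix.mul_assoc B, Matrix.mul_assoc B, Matrix.trace_mul_comm B]
      have h4 : (Y₂₂ * (K.BK * S.V * Bᵀ)).trace = (S.V * K.BKᵀ * Y₂₂ * B).trace := by
        rw [← h3, ← Matrix.trace_transpose, Matrix.trace_mul_comm Y₂₂]
        simp only [Matrix.transpose_mul, Matrix.transpose_transpose, sV, sY₂₂, Matrix.mul_assoc]
      have h5 : ∀ P Q : Matrix (Fin n) (Fin n) ℝ,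
          (P * (B * S.C) * Q).trace = (S.C * (Q * P) * B).trace := fun P Q => by
        rw [← Matrix.mul_assoc P, Matrix.mul_assoc, Matrix.trace_mul_comm]
        simp only [Matrix.mul_assoc]
      rw [Matrix.mul_add, Matrix.trace_add, h3, h4, h5, h5] at h
      rw [Matrix.mul_add, Matrix.add_mul, Matrix.add_mul, Matrix.trace_add, Matrix.trace_add]
      linarith
    have h2 := congrArg Matrix.transpose h1
    simpa [Matrix.transpose_add, Matrix.transpose_mul, sX₁₁, sY₂₂, sX₁₂, sX₂₁, sY₁₂, sY₂₁, sV,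
      Matrix.mul_assoc] using h2
  have gC : S.Bᵀ * (Y₁₁ * X₁₂ + Y₁₂ * X₂₂) + S.R * K.CK * X₂₂ = 0 := by
    have h1 : (X₂₁ * Y₁₁ + X₂₂ * Y₂₁) * S.B + X₂₂ * K.CKᵀ * S.R = 0 := by
      refine Matrix.eq_zero_of_forall_trace_mul fun C => ?_
      have h := hfo 0 0 C
      simp only [Matrix.transpose_zero, Matrix.zero_mul, Matrix.mul_zero, Matrix.trace_zero,
        zero_add, add_zero] at h
      have h3 : (K.CKᵀ * S.R * C * X₂₂).trace = (X₂₂ * K.CKᵀ * S.R * C).trace := by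
        rw [Matrix.trace_mul_comm]
        simp only [Matrix.mul_assoc]
      have h4 : (Cᵀ * S.R * K.CK * X₂₂).trace = (X₂₂ * K.CKᵀ * S.R * C).trace := by
        rw [← Matrix.trace_transpose]
        simp only [Matrix.transpose_mul, Matrix.transpose_transpose, sR, sX₂₂, Matrix.mul_assoc]
      have h5 : ∀ P Q : Matrix (Fin n) (Fin n) ℝ,
          (P * (S.B * C) * Q).trace = (Q * P * S.B * C).trace := fun P Q => by
        rw [Matrix.trace_mul_cycle]
        simp only [Matrix.mul_assoc]
      rw [Matrix.add_mul, Matrix.trace_add, h3, h4, h5, h5] at h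
      rw [Matrix.add_mul, Matrix.add_mul, Matrix.trace_add, Matrix.add_mul, Matrix.trace_add]
      linarith
    have h2 := congrArg Matrix.transpose h1
    simpa [Matrix.transpose_add, Matrix.transpose_mul, sX₂₂, sY₁₁, sX₁₂, sX₂₁, sY₁₂, sY₂₁, sR,
      Matrix.mul_assoc] using h2
  have key := Matrix.trace_cost_le_of_stationary hX hY hL hZ hS.posDef_R hS.posDef_V sX₁₁ sX₁₂.symm
    hX22 sY₁₁ sY₁₂.symm hY22 gA gB gC
  simpa [costWeight, Matrix.fromBlocks_multiply, Matrix.trace_fromBlocks'] using key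

end LQGProblem

end Stationary

/-! ### The main theorem. -/

theorem mainTheorem9 {n m p : ℕ} (S : LQGProblem n m p) (hS : S.Admissible)
    {Ω : Type*} [MeasurableSpace Ω] (P : Measure Ω) [IsProbabilityMeasure P]
    (w : ℝ≥0 → Ω → EuclideanSpace ℝ (Fin n)) (v : ℝ≥0 → Ω → EuclideanSpace ℝ (Fin p))
    (hw : IsWienerProcess S.W w P) (hv : IsWienerProcess S.V v P)
    (hwv : IndepFun (fun ω t => w t ω) (fun ω t => v t ω) P)
    (x ξ : Controller n m p → ℝ → Ω → Fin n → ℝ)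
    (hx : S.IsClosedLoopFamily P w v x ξ)
    (K : ℕ → Controller n m p) (α : ℕ → ℝ) (Kstar : Controller n m p)
    (hα : ∀ t, 0 ≤ α t) (hα_sum : ¬ Summable α)
    (hK : ∀ t, K t ∈ S.stabilizing)
    (hstep : ∀ t, K (t + 1) = K t - α t • gradient (S.cost P x ξ) (K t))
    (hlim : Tendsto K atTop (𝓝 Kstar)) (hKstar : Kstar ∈ S.stabilizing)
    (hctrl : IsControllable Kstar.AK Kstar.BK) (hobs : IsObservable Kstar.CK Kstar.AK) :
    (∀ L ∈ S.stabilizing,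
      (∀ T : ℝ, 0 ≤ T →
        Integrable (fun ω => S.runningCost L (fun t => x L t ω) (fun t => ξ L t ω) T) P) ∧
      Tendsto (S.averageCost L P (x L) (ξ L)) atTop (𝓝 (S.cost P x ξ L)) ∧
      DifferentiableAt ℝ (S.cost P x ξ) L) ∧
    gradient (S.cost P x ξ) Kstar = 0 ∧
    ∀ L ∈ S.stabilizing, S.cost P x ξ Kstar ≤ S.cost P x ξ L := by
  have hav := fun (L : Controller n m p) (hL : L ∈ S.stabilizing) =>
    hS.tendsto_averageCost hw hv hwv hL (hx.initial_x L hL) (hx.initial_xi L hL) (hx.path L hL)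
      (S.covariance_spec hL)
  have hcost : ∀ L ∈ S.stabilizing, S.cost P x ξ L = (S.costWeight L * S.covariance L).trace :=
    fun L hL => (hav L hL).2.limUnder_eq
  -- The trace formula for the cost is known only at stabilizing controllers; as these form an open
  -- set, derivatives there still agree.
  have hev : ∀ L ∈ S.stabilizing, S.cost P x ξ =ᶠ[𝓝 L]
      fun L => (S.costWeight L * S.covariance L).trace := fun L hL => by
    filter_upwards [S.isOpen_stabilizing.mem_nhds hL] with L' hL' using hcost L' hL'
  have hsmooth : ∀ L ∈ S.stabilizing, ContDiffAt ℝ 1 (S.cost P x ξ) L := fun L hL =>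
    (S.contDiffAt_trace 1 hL).congr_of_eventuallyEq (hev L hL)
  have hgrad : gradient (S.cost P x ξ) Kstar = 0 := by
    refine eq_zero_of_tendsto_descent hα hα_sum hstep hlim ?_
    have h1 : ContinuousAt (fderiv ℝ (S.cost P x ξ)) Kstar :=
      ((hsmooth Kstar hKstar).fderiv_right (m := 0) le_rfl).continuousAt
    exact (InnerProductSpace.toDual ℝ (Controller n m p)).symm.continuous.continuousAt.comp h1
  refine ⟨fun L hL => ⟨(hav L hL).1, ?_, (hsmooth L hL).differentiableAt (by simp)⟩, hgrad,
    fun L hL => ?_⟩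
  · rw [hcost L hL]
    exact (hav L hL).2
  · have hd : HasFDerivAt (S.cost P x ξ) (0 : Controller n m p →L[ℝ] ℝ) Kstar := by
      have h1 := ((hsmooth Kstar hKstar).differentiableAt (by simp)).hasGradientAt
      rw [hgrad] at h1
      simpa using h1.hasFDerivAt
    rw [hcost L hL, hcost Kstar hKstar]
    exact hS.le_of_stationary hKstar hL (hd.congr_of_eventuallyEq (hev Kstar hKstar).symm) hctrl hobs
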